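/- Let $\mathcal L$ be a self-adjoint (possibly unbounded) operator on a complex Hilbert space $\mathcal H$ with projection-valued spectral measure $\mathcal E$, that is, $\mathcal L=\int_{\mathbb R} y\,d\mathcal E(y)$ with domain $\{x:\int y^2\,d\langle \mathcal E(y)x,x\rangle<\infty\}$. Let $f\in\mathcal H$ with $\|f\|=1$, let $\mu_f(\Omega)=\langle\mathcal E(\Omega)f,f\rangle$ ($\Omega\subset\mathbb R$ Borel) be the spectral measure of $\mathcal L$ with respect to $f$, and let $\rho_f$ be the Radon--Nikodym derivative of the absolutely continuous component of $\mu_f$ with respect to Lebesgue measure. For an integer $m\ge 1$, a function $K\in L^1(\mathbb R)$ (real- or complex-valued) is called an $m$th order kernel if (i) $\int_{\mathbb R}K(x)\,dx=1$; (ii) $K(x)x^j$ is integrable and $\int_{\mathbb R}K(x)x^j\,dx=0$ for $0<j<m$; (iii) there is a constant $C_K$ such that $|K(x)|\le C_K(1+|x|)^{-(m+1)}$ for all $x\in\mathbb R$. Put $K_\epsilon(x)=\epsilon^{-1}K(x/\epsilon)$ and $[K_\epsilon*\mu_f](x)=\int_{\mathbb R}K_\epsilon(x-y)\,d\mu_f(y)$.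 For an open interval $I$ and $1\le p<\infty$ let $\|u\|_{\mathcal W^{m,p}(I)}=\bigl(\sum_{j=0}^m\|u^{(j)}\|_{L^p(I)}^p\bigr)^{1/p}$ (weak derivatives). **Theorem.** For every $m\ge1$ there is a constant $C(m)$, depending only on $m$, such that the following holds. Let $K$ be an $m$th order kernel, let $C_K$ be any constant for which (iii) holds, let $1\le p<\infty$, $a<b$ and $\eta>0$. Suppose that $\mu_f$ is absolutely continuous on $I=(a-\eta,b+\eta)$ and that $\rho_I:=\rho_f|_I\in\mathcal W^{m,p}(I)$. Then for every $\epsilon>0$ the function $\rho_I-[K_\epsilon*\mu_f]$ belongs to $L^p((a,b))$ and $$ \|\rho_I-[K_\epsilon*\mu_f]\|_{L^p((a,b))}\le \frac{C_K(b-a)^{1/p}}{(\epsilon+\frac{\eta}{2})^{m+1}}\,\epsilon^m +C(m)\,C_K\,\|\rho_I\|_{\mathcal W^{m,p}(I)}\,(1+\eta^{-m})\,\log\!\Bigl(1+\frac{b-a+2\eta}{\epsilon}\Bigr)\epsilon^m . $$ In particular $\|\rho_I-[K_\epsilon*\mu_f]\|_{L^p((a,b))}=\mathcal O(\epsilon^m\log(1/\epsilon))$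 as $\epsilon\downarrow0$. -/

import Mathlib

open MeasureTheory Set Filter Topology
open scoped ENNReal ContDiff

/-! ### Projection-valued measures and spectral measures -/

/-- A projection-valued Borel measure on `ℝ` acting on a Hilbert space `H`: orthogonal projections
`E Ω` with `E ℝ = 1`, strongly countably additive. Only the values on Borel sets matter. -/
structure ProjectionValuedMeasure (H : Type*) [NormedAddCommGroup H] [InnerProductSpace ℂ H]
    [CompleteSpace H] where
  toFun : Set ℝ → H →L[ℂ] H
  isStarProjection : ∀ Ω : Set ℝ, MeasurableSet Ω → IsStarProjection (toFun Ω)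
  map_univ : toFun univ = 1
  hasSum_iUnion : ∀ s : ℕ → Set ℝ, (∀ i, MeasurableSet (s i)) →
    Pairwise (Function.onFun Disjoint s) →
    ∀ x : H, HasSum (fun i => toFun (s i) x) (toFun (⋃ i, s i) x)

namespace ProjectionValuedMeasure

variable {H : Type*} [NormedAddCommGroup H] [InnerProductSpace ℂ H] [CompleteSpace H]

theorem toFun_empty (E : ProjectionValuedMeasure H) (x : H) : E.toFun ∅ x = 0 := by
  have h := E.hasSum_iUnion (fun _ => ∅) (fun _ => MeasurableSet.empty)
    (fun i j _ => by simp [Function.onFun]) x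
  simpa using h.summable.tendsto_atTop_zero

theorem re_inner_nonneg (E : ProjectionValuedMeasure H) (x : H) {Ω : Set ℝ}
    (hΩ : MeasurableSet Ω) : 0 ≤ (inner ℂ x (E.toFun Ω x)).re := by
  obtain ⟨h1, h2⟩ := E.isStarProjection Ω hΩ
  have h3 : E.toFun Ω (E.toFun Ω x) = E.toFun Ω x := by
    have := congrArg (fun T : H →L[ℂ] H => T x) h1.eq
    simpa using this
  have h4 : inner ℂ x (E.toFun Ω x) = inner ℂ (E.toFun Ω x) (E.toFun Ω x) := by
    conv_lhs => rw [← h3]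
    rw [← ContinuousLinearMap.adjoint_inner_left, ← ContinuousLinearMap.star_eq_adjoint, h2.star_eq]
  rw [h4]
  exact inner_self_nonneg (𝕜 := ℂ)

/-- The scalar spectral measure `Ω ↦ ⟨E(Ω) f, f⟩` (a real nonnegative number for Borel `Ω`). -/
noncomputable def spectralMeasure (E : ProjectionValuedMeasure H) (f : H) : Measure ℝ :=
  Measure.ofMeasurable (fun Ω _ => ENNReal.ofReal (inner ℂ f (E.toFun Ω f)).re)
    (by simp [E.toFun_empty f])
    (by
      intro s hs hd
      have h1 : HasSum (fun i => (inner ℂ f (E.toFun (s i) f)).re)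
          (inner ℂ f (E.toFun (⋃ i, s i) f)).re :=
        Complex.hasSum_re ((E.hasSum_iUnion s hs hd f).mapL (innerSL ℂ f))
      rw [← h1.tsum_eq, ENNReal.ofReal_tsum_of_nonneg
        (fun i => E.re_inner_nonneg f (hs i)) h1.summable])

theorem spectralMeasure_apply (E : ProjectionValuedMeasure H) (f : H) {Ω : Set ℝ}
    (hΩ : MeasurableSet Ω) :
    E.spectralMeasure f Ω = ENNReal.ofReal (inner ℂ f (E.toFun Ω f)).re :=
  Measure.ofMeasurable_apply Ω hΩ

/-- `L = ∫ y dE(y)`: the domain of `L` consists of the `x` with `∫ y² d⟨E(y) x, x⟩ < ∞`, and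
`⟨L x, x⟩ = ∫ y d⟨E(y) x, x⟩` there (this determines `L` by polarization). -/
def IsResolutionOf (E : ProjectionValuedMeasure H) (L : H →ₗ.[ℂ] H) : Prop :=
  (∀ x : H, x ∈ L.domain ↔ ∫⁻ y, ENNReal.ofReal (y ^ 2) ∂(E.spectralMeasure x) < ⊤) ∧
  ∀ x : L.domain, inner ℂ (x : H) (L x) = ((∫ y, y ∂(E.spectralMeasure (x : H)) : ℝ) : ℂ)

end ProjectionValuedMeasure

/-- The Radon--Nikodym derivative of the absolutely continuous component of `μ`
with respect to Lebesgue measure. -/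
noncomputable def acDensity (μ : Measure ℝ) (x : ℝ) : ℝ := (μ.rnDeriv volume x).toReal

/-! ### Kernels -/

/-- The decay bound `|K(x)| ≤ C / (1 + |x|)^(m+1)` for all `x`. -/
def KernelDecay (m : ℕ) (K : ℝ → ℂ) (C : ℝ) : Prop :=
  ∀ x : ℝ, ‖K x‖ ≤ C / (1 + |x|) ^ (m + 1)

/-- `m`-th order kernels. -/
structure IsKernelOfOrder (m : ℕ) (K : ℝ → ℂ) : Prop where
  pos : 0 < m
  integrable : Integrable K
  integral_eq_one : ∫ x, K x = 1
  moments : ∀ j : ℕ, 0 < j → j < m →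
    Integrable (fun x : ℝ => K x * (x : ℂ) ^ j) ∧ ∫ x : ℝ, K x * (x : ℂ) ^ j = 0
  decay : ∃ C : ℝ, KernelDecay m K C

/-- The rescaled kernel `K_ε(x) = ε⁻¹ K(x / ε)`. -/
noncomputable def scaledKernel (K : ℝ → ℂ) (ε : ℝ) (x : ℝ) : ℂ := (ε : ℂ)⁻¹ * K (x / ε)

/-- The smoothed measure `[K_ε * μ](x) = ∫ K_ε(x - y) dμ(y)`. -/
noncomputable def smoothedMeasure (K : ℝ → ℂ) (ε : ℝ) (μ : Measure ℝ) (x : ℝ) : ℂ :=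
  ∫ y, scaledKernel K ε (x - y) ∂μ

/-! ### Sobolev spaces on open subsets of the line -/

/-- `v` is a `k`-th weak derivative of `u` on the open set `U`. -/
def IsWeakDerivOn (U : Set ℝ) (k : ℕ) (u v : ℝ → ℝ) : Prop :=
  LocallyIntegrableOn u U ∧ LocallyIntegrableOn v U ∧
  ∀ φ : ℝ → ℝ, ContDiff ℝ ∞ φ → HasCompactSupport φ → tsupport φ ⊆ U →
    ∫ x in U, v x * φ x = (-1) ^ k * ∫ x in U, u x * iteratedDeriv k φ x

/-- `u ∈ W^{k,p}(U)`: `u` has weak derivatives of all orders `0, …, k` on `U`, all in `L^p(U)`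
(order `0` says that `u` itself is in `L^p(U)`). -/
def MemSobolev (U : Set ℝ) (k : ℕ) (p : ℝ≥0∞) (u : ℝ → ℝ) : Prop :=
  ∀ j ≤ k, ∃ v : ℝ → ℝ, IsWeakDerivOn U j u v ∧ MemLp v p (volume.restrict U)

open Classical in
/-- The `k`-th weak derivative of `u` on `U` (unique up to null sets), or `0` if there is none. -/
noncomputable def weakDerivOn (U : Set ℝ) (k : ℕ) (u : ℝ → ℝ) : ℝ → ℝ :=
  if h : ∃ v : ℝ → ℝ, IsWeakDerivOn U k u v then h.choose else 0

/-- The norm of `W^{k,p}(U)` for `1 ≤ p < ∞`: `(∑_{j ≤ k} ‖u^{(j)}‖_{L^p(U)}^p)^{1/p}`. -/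
noncomputable def sobolevNorm (U : Set ℝ) (k : ℕ) (p : ℝ≥0∞) (u : ℝ → ℝ) : ℝ :=
  (∑ j ∈ Finset.range (k + 1),
    (eLpNorm (weakDerivOn U j u) p (volume.restrict U)).toReal ^ p.toReal) ^ (1 / p.toReal)

/-- Weak derivatives are unique almost everywhere, so `sobolevNorm` does not depend on the choice
made in `weakDerivOn`. -/
theorem IsWeakDerivOn.ae_eq {U : Set ℝ} (hU : IsOpen U) {k : ℕ} {u v w : ℝ → ℝ}
    (hv : IsWeakDerivOn U k u v) (hw : IsWeakDerivOn U k u w) :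
    v =ᵐ[volume.restrict U] w := by
  have key : ∀ᵐ x ∂volume, x ∈ U → (v - w) x = 0 := by
    refine hU.ae_eq_zero_of_integral_contDiff_smul_eq_zero (hv.2.1.sub hw.2.1) ?_
    intro φ h1 h2 h3
    have hint : ∀ g : ℝ → ℝ, LocallyIntegrableOn g U → Integrable (fun x => φ x * g x) := by
      intro g hg
      have h := (hg.integrableOn_compact_subset h3 h2)
      have h' : IntegrableOn (fun x => φ x * g x) (tsupport φ) :=
        h.continuousOn_mul h1.continuous.continuousOn h2
      rwa [integrableOn_iff_integrable_of_support_subset] at h'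
      exact (Function.support_mul_subset_left φ g).trans (subset_tsupport φ)
    have hset : ∀ g : ℝ → ℝ, ∫ x in U, g x * φ x = ∫ x, φ x * g x := by
      intro g
      rw [setIntegral_eq_integral_of_forall_compl_eq_zero]
      · simp_rw [mul_comm]
      · intro x hx
        rw [image_eq_zero_of_notMem_tsupport (fun h => hx (h3 h)), mul_zero]
    have e := (hv.2.2 φ h1 h2 h3).trans (hw.2.2 φ h1 h2 h3).symm
    rw [hset, hset] at e
    simp only [Pi.sub_apply, smul_eq_mul, mul_sub]
    rw [integral_sub (hint v hv.2.1) (hint w hw.2.1), e, sub_self]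
  rw [Filter.EventuallyEq, ae_restrict_iff' hU.measurableSet]
  filter_upwards [key] with x hx h
  exact sub_eq_zero.mp (hx h)

/-!
Write `ρ` for the density of the spectral measure `μ`. Only three facts about `μ` matter: it is a
probability measure, it has density `ρ` on `I = (a - η, b + η)`, and `ρ` is a Sobolev function
there.

A cutoff function `χ`, supported in `I` and equal to `1` on the `η / 2`-neighbourhood of `(a, b)`,
splits `μ` into `(1 - χ) μ` and `χ μ`. The first part has mass at most `1` and stays at distance
`η / 2` from `(a, b)`, so the decay of the kernel alone gives the first term of the bound
(`eLpNorm_far_part_le`).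

The second part has density `g = χ ρ`, a compactly supported function on the whole line whose weak
derivative `h` of order `m` is given by the Leibniz rule (`leibnizSum`) and has `L^p` norm at most a
constant times `(1 + η⁻ᵐ) ‖ρ‖` (`exists_cutoff`, `eLpNorm_leibnizSum_le`). By Cauchy's formula for
repeated integration, `g` is the convolution of `h` with `P(s) = s₊^(m-1) / (m-1)!`
(`ae_eq_integral_cauchyKernel_mul`). Hence, for `k = K_ε`,
`g - k * g = (P - k * P) * h`, and the residual kernel `P - k * P` satisfies
`|P - k * P| (s) ≤ const * C_K * ε ^ m / (ε + |s|)` (`norm_residualKernel_le`): for `s ≤ 0` only the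
values `k(y)` with `y < s` enter, and for `s > 0` only those with `y > s`, because the vanishing
moments of `k` make it reproduce the polynomial `s ↦ s^(m-1)`. For `x ∈ (a, b)` and `h`
supported in `I` only `|s| ≤ b - a + 2 η` matters, and there the residual kernel has `L^1` norm at
most `const * C_K * ε ^ m * log (1 + (b - a + 2 η) / ε)`. Young's inequality gives the second term
(`eLpNorm_near_part_le`).

The kernel `K` is only Lebesgue measurable and `μ` may be singular outside `I`, so `y ↦ K_ε (x - y)`
is `μ`-measurable only for almost every `x`; this suffices for an `L^p` statement.
-/

/-! ### Smooth cutoff functions -/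

theorem exists_bound_iteratedDeriv_smoothTransition (i : ℕ) :
    ∃ M : ℝ, ∀ x, |iteratedDeriv i Real.smoothTransition x| ≤ M := by
  have hc : Continuous (iteratedDeriv i Real.smoothTransition) :=
    (Real.smoothTransition.contDiff (n := ⊤)).continuous_iteratedDeriv i (by exact_mod_cast le_top)
  rcases Nat.eq_zero_or_pos i with rfl | hi
  · refine ⟨1, fun x => ?_⟩
    rw [iteratedDeriv_zero, abs_of_nonneg (Real.smoothTransition.nonneg x)]
    exact Real.smoothTransition.le_one x
  · -- the derivative vanishes off `[0, 1]`, where the function is locally constant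
    obtain ⟨M, hM⟩ := isCompact_Icc.exists_bound_of_continuousOn (s := Icc (0 : ℝ) 1)
      hc.continuousOn
    have hM0 : 0 ≤ M := (norm_nonneg _).trans (hM 0 ⟨le_rfl, zero_le_one⟩)
    refine ⟨M, fun x => ?_⟩
    by_cases hx : x ∈ Icc (0 : ℝ) 1
    · exact hM x hx
    · have key : iteratedDeriv i Real.smoothTransition x = 0 := by
        rcases lt_or_ge x 0 with h | h
        · have e : Real.smoothTransition =ᶠ[𝓝 x] fun _ => (0 : ℝ) := by
            filter_upwards [Iio_mem_nhds h] with y hy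
            exact Real.smoothTransition.zero_of_nonpos (le_of_lt hy)
          rw [e.iteratedDeriv_eq, iteratedDeriv_const]
          simp [hi.ne']
        · have h1 : 1 < x := by
            by_contra h'
            exact hx ⟨h, not_lt.mp h'⟩
          have e : Real.smoothTransition =ᶠ[𝓝 x] fun _ => (1 : ℝ) := by
            filter_upwards [Ioi_mem_nhds h1] with y hy
            exact Real.smoothTransition.one_of_one_le (le_of_lt hy)
          rw [e.iteratedDeriv_eq, iteratedDeriv_const]
          simp [hi.ne']
      rw [key, abs_zero]
      exact hM0

/-- The iterated derivatives of an affine rescaling of the smooth transition function. -/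
theorem iteratedDeriv_smoothTransition_affine (i : ℕ) (c d x : ℝ) :
    iteratedDeriv i (fun x => Real.smoothTransition (c * x + d)) x
      = c ^ i * iteratedDeriv i Real.smoothTransition (c * x + d) := by
  have h1 := iteratedDeriv_comp_const_mul (𝕜 := ℝ) (n := i)
    (f := fun y => Real.smoothTransition (y + d))
    (Real.smoothTransition.contDiff.comp (contDiff_id.add contDiff_const)) c
  rw [iteratedDeriv_comp_add_const] at h1
  exact congrFun h1 x

theorem inv_pow_le_one_add_inv_pow {η : ℝ} (hη : 0 < η) {i m : ℕ} (him : i ≤ m) :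
    (η ^ i)⁻¹ ≤ 1 + (η ^ m)⁻¹ := by
  rcases le_total 1 η with h | h
  · have : (η ^ i)⁻¹ ≤ 1 := inv_le_one_of_one_le₀ (one_le_pow₀ h)
    have : 0 ≤ (η ^ m)⁻¹ := by positivity
    linarith
  · have : (η ^ i)⁻¹ ≤ (η ^ m)⁻¹ :=
      inv_anti₀ (pow_pos hη m) (pow_le_pow_of_le_one hη.le h him)
    linarith

/-- Cutoff functions of an interval inside its `η`-neighbourhood, equal to `1` on the
`η / 2`-neighbourhood, whose derivatives have the expected size in `η`, with a constant that does
not depend on the interval. -/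
theorem exists_cutoff (m : ℕ) :
    ∃ M : ℝ, 0 ≤ M ∧ ∀ a b η : ℝ, a < b → 0 < η → ∃ χ : ℝ → ℝ, ContDiff ℝ ∞ χ ∧
      HasCompactSupport χ ∧ tsupport χ ⊆ Ioo (a - η) (b + η) ∧ (∀ x, 0 ≤ χ x) ∧ (∀ x, χ x ≤ 1) ∧
      (∀ x ∈ Icc (a - η / 2) (b + η / 2), χ x = 1) ∧
      ∀ i ≤ m, ∀ x, |iteratedDeriv i χ x| ≤ M * (1 + (η ^ m)⁻¹) := by
  choose B hB using exists_bound_iteratedDeriv_smoothTransition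
  have hB0 : ∀ i, 0 ≤ B i := fun i => (abs_nonneg _).trans (hB i 0)
  set S := ∑ i ∈ Finset.range (m + 1), B i
  have hS0 : 0 ≤ S := Finset.sum_nonneg fun i _ => hB0 i
  refine ⟨2 * 4 ^ m * S + 1, by positivity, ?_⟩
  intro a b η hab hη
  set s := Real.smoothTransition
  set u : ℝ → ℝ := fun x => s (4 / η * x + (3 - 4 * a / η))
  set w : ℝ → ℝ := fun x => s ((-(4 / η)) * x + (3 + 4 * b / η))
  have hu1 : ∀ x, a - η / 2 ≤ x → u x = 1 := fun x hx => by
    refine Real.smoothTransition.one_of_one_le ?_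
    have : 4 / η * x + (3 - 4 * a / η) = 1 + 4 / η * (x - (a - η / 2)) := by field_simp; ring
    rw [this]
    have : 0 ≤ 4 / η * (x - (a - η / 2)) := mul_nonneg (by positivity) (by linarith)
    linarith
  have hw1 : ∀ x, x ≤ b + η / 2 → w x = 1 := fun x hx => by
    refine Real.smoothTransition.one_of_one_le ?_
    have : (-(4 / η)) * x + (3 + 4 * b / η) = 1 + 4 / η * ((b + η / 2) - x) := by field_simp; ring
    rw [this]
    have : 0 ≤ 4 / η * ((b + η / 2) - x) := mul_nonneg (by positivity) (by linarith)
    linarith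
  have hu0 : ∀ x, x ≤ a - 3 * η / 4 → u x = 0 := fun x hx => by
    refine Real.smoothTransition.zero_of_nonpos ?_
    have : 4 / η * x + (3 - 4 * a / η) = -(4 / η * ((a - 3 * η / 4) - x)) := by field_simp; ring
    rw [this]
    have : 0 ≤ 4 / η * ((a - 3 * η / 4) - x) := mul_nonneg (by positivity) (by linarith)
    linarith
  have hw0 : ∀ x, b + 3 * η / 4 ≤ x → w x = 0 := fun x hx => by
    refine Real.smoothTransition.zero_of_nonpos ?_
    have : (-(4 / η)) * x + (3 + 4 * b / η) = -(4 / η * (x - (b + 3 * η / 4))) := by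
      field_simp; ring
    rw [this]
    have : 0 ≤ 4 / η * (x - (b + 3 * η / 4)) := mul_nonneg (by positivity) (by linarith)
    linarith
  have hus : ContDiff ℝ ∞ u := Real.smoothTransition.contDiff.comp
    ((contDiff_const.mul contDiff_id).add contDiff_const)
  have hws : ContDiff ℝ ∞ w := Real.smoothTransition.contDiff.comp
    ((contDiff_const.mul contDiff_id).add contDiff_const)
  -- at every point one of the two steps equals `1`, so that the sum minus `1` is the other one
  set χ : ℝ → ℝ := fun x => (-1 + u x) + w x
  have hcase : ∀ x, χ x = u x ∨ χ x = w x := fun x => by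
    rcases le_total x ((a + b) / 2) with h | h
    · left; simp only [χ]; rw [hw1 x (by linarith)]; ring
    · right; simp only [χ]; rw [hu1 x (by linarith)]; ring
  have hsupp : tsupport χ ⊆ Icc (a - 3 * η / 4) (b + 3 * η / 4) := by
    refine closure_minimal ?_ isClosed_Icc
    intro x hx
    by_contra h
    apply hx
    rw [mem_Icc, not_and_or, not_le, not_le] at h
    simp only [χ]
    rcases h with h | h
    · rw [hu0 x h.le, hw1 x (by linarith)]; ring
    · rw [hw0 x h.le, hu1 x (by linarith)]; ring
  refine ⟨χ, (contDiff_const.add hus).add hws,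
    isCompact_Icc.of_isClosed_subset (isClosed_tsupport χ) hsupp,
    hsupp.trans fun x hx => ⟨by linarith [hx.1], by linarith [hx.2]⟩, fun x => ?_, fun x => ?_,
    fun x hx => ?_, fun i hi x => ?_⟩
  · rcases hcase x with h | h <;> rw [h] <;> exact Real.smoothTransition.nonneg _
  · rcases hcase x with h | h <;> rw [h] <;> exact Real.smoothTransition.le_one _
  · simp only [χ]; rw [hu1 x hx.1, hw1 x hx.2]; ring
  · have hpos : 0 ≤ (η ^ m)⁻¹ := by positivity
    rcases Nat.eq_zero_or_pos i with rfl | hi0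
    · have h1 : |χ x| ≤ 1 := by
        rcases hcase x with h | h <;> rw [h, abs_of_nonneg (Real.smoothTransition.nonneg _)] <;>
          exact Real.smoothTransition.le_one _
      rw [iteratedDeriv_zero]
      have : (0 : ℝ) ≤ 2 * 4 ^ m * S := by positivity
      nlinarith
    · have hd : iteratedDeriv i χ x = iteratedDeriv i u x + iteratedDeriv i w x := by
        have hle : ((i : ℕ) : WithTop ℕ∞) ≤ ((⊤ : ℕ∞) : WithTop ℕ∞) := by exact_mod_cast le_top
        have h1 : iteratedDeriv i ((fun x => -1 + u x) + w) x
            = iteratedDeriv i (fun x => -1 + u x) x + iteratedDeriv i w x :=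
          iteratedDeriv_add (((contDiff_const.add hus).of_le hle).contDiffAt)
            ((hws.of_le hle).contDiffAt)
        rw [iteratedDeriv_const_add hi0] at h1
        exact h1
      have hsz : 4 ^ i / η ^ i * B i ≤ 4 ^ m * S * (1 + (η ^ m)⁻¹) := by
        have h1 : (4 : ℝ) ^ i ≤ 4 ^ m := pow_le_pow_right₀ (by norm_num) hi
        have h2 : B i ≤ S :=
          Finset.single_le_sum (fun j _ => hB0 j) (Finset.mem_range.mpr (by omega))
        have h3 := inv_pow_le_one_add_inv_pow hη hi
        calc 4 ^ i / η ^ i * B i = (4 ^ i * B i) * (η ^ i)⁻¹ := by ring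
          _ ≤ (4 ^ m * S) * (1 + (η ^ m)⁻¹) := by
            have := hB0 i
            gcongr
      have h1 : |iteratedDeriv i u x| ≤ 4 ^ i / η ^ i * B i := by
        rw [iteratedDeriv_smoothTransition_affine, abs_mul, abs_pow, abs_of_pos (by positivity),
          div_pow]
        exact mul_le_mul_of_nonneg_left (hB i _) (by positivity)
      have h2 : |iteratedDeriv i w x| ≤ 4 ^ i / η ^ i * B i := by
        rw [iteratedDeriv_smoothTransition_affine, abs_mul, abs_pow, abs_neg,
          abs_of_pos (by positivity), div_pow]
        exact mul_le_mul_of_nonneg_left (hB i _) (by positivity)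
      rw [hd]
      refine (abs_add_le _ _).trans ?_
      nlinarith

/-! ### Weak derivatives of the product with a cutoff function -/

theorem MeasureTheory.LocallyIntegrableOn.integrable_mul_of_tsupport_subset {U : Set ℝ}
    {φ g : ℝ → ℝ} (hg : LocallyIntegrableOn g U) (h1 : Continuous φ) (h2 : HasCompactSupport φ)
    (h3 : tsupport φ ⊆ U) : Integrable (fun x => φ x * g x) := by
  have h' : IntegrableOn (fun x => φ x * g x) (tsupport φ) :=
    (hg.integrableOn_compact_subset h3 h2).continuousOn_mul h1.continuousOn h2
  rwa [integrableOn_iff_integrable_of_support_subset] at h'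
  exact (Function.support_mul_subset_left φ g).trans (subset_tsupport φ)

theorem setIntegral_mul_eq_integral_of_tsupport_subset {U : Set ℝ} {φ : ℝ → ℝ}
    (h3 : tsupport φ ⊆ U) (g : ℝ → ℝ) : ∫ x in U, g x * φ x = ∫ x, φ x * g x := by
  rw [setIntegral_eq_integral_of_forall_compl_eq_zero]
  · simp_rw [mul_comm]
  · intro x hx
    rw [image_eq_zero_of_notMem_tsupport (fun h => hx (h3 h)), mul_zero]


/-- A weak derivative of order `j + 1` is a first weak derivative of the one of order `j`. -/
theorem IsWeakDerivOn.succ {U : Set ℝ} {j : ℕ} {u v w : ℝ → ℝ} (hv : IsWeakDerivOn U j u v)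
    (hw : IsWeakDerivOn U (j + 1) u w) : IsWeakDerivOn U 1 v w := by
  refine ⟨hv.2.1, hw.2.1, fun φ h1 h2 h3 => ?_⟩
  rw [hw.2.2 φ h1 h2 h3, iteratedDeriv_one, hv.2.2 (deriv φ)
    (contDiff_infty_iff_deriv.mp h1).2 h2.deriv (tsupport_deriv_subset.trans h3),
    iteratedDeriv_succ']
  ring

theorem IsWeakDerivOn.integral_mul_eq_neg {U : Set ℝ} {v w φ : ℝ → ℝ} (h : IsWeakDerivOn U 1 v w)
    (h1 : ContDiff ℝ ∞ φ) (h2 : HasCompactSupport φ) (h3 : tsupport φ ⊆ U) :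
    ∫ x, φ x * w x = -∫ x, deriv φ x * v x := by
  have e := h.2.2 φ h1 h2 h3
  rw [iteratedDeriv_one, setIntegral_mul_eq_integral_of_tsupport_subset h3,
    setIntegral_mul_eq_integral_of_tsupport_subset (tsupport_deriv_subset.trans h3)] at e
  rw [e]
  ring

/-- The `m`-th derivative of `χ * u` as given by the Leibniz rule, when `v j` stands for the `j`-th
derivative of `u`: the product rule is applied recursively instead of writing binomial
coefficients. -/
noncomputable def leibnizSum : ℕ → (ℝ → ℝ) → (ℕ → ℝ → ℝ) → ℝ → ℝ
  | 0, χ, v => fun x => χ x * v 0 x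
  | m + 1, χ, v => fun x => leibnizSum m (deriv χ) v x + leibnizSum m χ (fun j => v (j + 1)) x

theorem leibnizSum_eq_zero (m : ℕ) (χ : ℝ → ℝ) (v : ℕ → ℝ → ℝ) {x : ℝ} (hx : x ∉ tsupport χ) :
    leibnizSum m χ v x = 0 := by
  induction m generalizing χ v with
  | zero => simp [leibnizSum, image_eq_zero_of_notMem_tsupport hx]
  | succ m ih =>
    simp only [leibnizSum]
    rw [ih _ _ (fun h => hx (tsupport_deriv_subset h)), ih _ _ hx, add_zero]

theorem integrable_leibnizSum_mul {U : Set ℝ} (m : ℕ) {χ : ℝ → ℝ} {v : ℕ → ℝ → ℝ} {Φ : ℝ → ℝ}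
    (h1 : ContDiff ℝ ∞ χ) (h2 : HasCompactSupport χ) (h3 : tsupport χ ⊆ U)
    (hv : ∀ j ≤ m, LocallyIntegrableOn (v j) U) (hΦ : Continuous Φ) :
    Integrable (fun x => leibnizSum m χ v x * Φ x) := by
  induction m generalizing χ v with
  | zero =>
    have h := (hv 0 le_rfl).integrable_mul_of_tsupport_subset (φ := fun x => χ x * Φ x)
      (h1.continuous.mul hΦ) h2.mul_right (tsupport_mul_subset_left.trans h3)
    refine h.congr (Eventually.of_forall fun x => ?_)
    simp only [leibnizSum]
    ring
  | succ m ih =>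
    simp only [leibnizSum, add_mul]
    exact (ih (contDiff_infty_iff_deriv.mp h1).2 h2.deriv (tsupport_deriv_subset.trans h3)
      (fun j hj => hv j (by omega))).add (ih h1 h2 h3 (fun j hj => hv (j + 1) (by omega)))

/-- `leibnizSum` is the weak derivative of `χ * u` on the whole line. The test function need not
have compact support, since `χ` has. -/
theorem integral_leibnizSum_mul {U : Set ℝ} (m : ℕ) {χ : ℝ → ℝ} {v : ℕ → ℝ → ℝ} {Φ : ℝ → ℝ}
    (h1 : ContDiff ℝ ∞ χ) (h2 : HasCompactSupport χ) (h3 : tsupport χ ⊆ U)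
    (hv : ∀ j ≤ m, LocallyIntegrableOn (v j) U)
    (hw : ∀ j < m, IsWeakDerivOn U 1 (v j) (v (j + 1))) (hΦ : ContDiff ℝ ∞ Φ) :
    ∫ x, leibnizSum m χ v x * Φ x = (-1) ^ m * ∫ x, χ x * v 0 x * iteratedDeriv m Φ x := by
  induction m generalizing χ v with
  | zero => simp [leibnizSum]
  | succ m ih =>
    have hχ' := (contDiff_infty_iff_deriv.mp h1).2
    have h3' := (tsupport_deriv_subset (f := χ)).trans h3
    have hsm : ∀ k, ContDiff ℝ ∞ (iteratedDeriv k Φ) := fun k => by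
      induction k with
      | zero => simpa using hΦ
      | succ k ihk => rw [iteratedDeriv_succ]; exact (contDiff_infty_iff_deriv.mp ihk).2
    have hd : ∀ x, deriv (fun x => χ x * iteratedDeriv m Φ x) x
        = deriv χ x * iteratedDeriv m Φ x + χ x * iteratedDeriv (m + 1) Φ x := fun x => by
      rw [iteratedDeriv_succ]
      exact deriv_fun_mul ((h1.differentiable (by simp)) x)
        (((hsm m).differentiable (by simp)) x)
    simp only [leibnizSum, add_mul]
    rw [integral_add
      (integrable_leibnizSum_mul m hχ' h2.deriv h3' (fun j hj => hv j (by omega)) hΦ.continuous)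
      (integrable_leibnizSum_mul m h1 h2 h3 (fun j hj => hv (j + 1) (by omega)) hΦ.continuous),
      ih hχ' h2.deriv h3' (fun j hj => hv j (by omega)) (fun j hj => hw j (by omega)),
      ih h1 h2 h3 (fun j hj => hv (j + 1) (by omega)) (fun j hj => hw (j + 1) (by omega))]
    have e := (hw 0 (by omega)).integral_mul_eq_neg (φ := fun x => χ x * iteratedDeriv m Φ x)
      (h1.mul (hsm m)) h2.mul_right (tsupport_mul_subset_left.trans h3)
    have i1 : Integrable (fun x => deriv χ x * v 0 x * iteratedDeriv m Φ x) := by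
      simpa [leibnizSum] using integrable_leibnizSum_mul 0 hχ' h2.deriv h3'
        (fun j hj => hv j (by omega)) (hsm m).continuous
    have i2 : Integrable (fun x => χ x * v 0 x * iteratedDeriv (m + 1) Φ x) := by
      simpa [leibnizSum] using integrable_leibnizSum_mul 0 h1 h2 h3
        (fun j hj => hv j (by omega)) (hsm (m + 1)).continuous
    have e1 : ∫ x, χ x * v (0 + 1) x * iteratedDeriv m Φ x
        = -((∫ x, deriv χ x * v 0 x * iteratedDeriv m Φ x)
          + ∫ x, χ x * v 0 x * iteratedDeriv (m + 1) Φ x) := by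
      rw [← integral_add i1 i2]
      calc _ = ∫ x, χ x * iteratedDeriv m Φ x * v (0 + 1) x :=
            integral_congr_ae (Eventually.of_forall fun x => by ring)
        _ = _ := by
            rw [e]
            congr 1
            refine integral_congr_ae (Eventually.of_forall fun x => ?_)
            simp only [hd]
            ring
    rw [e1]
    ring

theorem integrable_leibnizSum {U : Set ℝ} (m : ℕ) {χ : ℝ → ℝ} {v : ℕ → ℝ → ℝ}
    (h1 : ContDiff ℝ ∞ χ) (h2 : HasCompactSupport χ) (h3 : tsupport χ ⊆ U)
    (hv : ∀ j ≤ m, LocallyIntegrableOn (v j) U) : Integrable (leibnizSum m χ v) := by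
  simpa using integrable_leibnizSum_mul m h1 h2 h3 hv (continuous_const (y := (1 : ℝ)))

theorem eLpNorm_leibnizSum_le {U : Set ℝ} (hU : MeasurableSet U) (m : ℕ) {p : ℝ≥0∞} (hp : 1 ≤ p)
    {χ : ℝ → ℝ} {v : ℕ → ℝ → ℝ} {B : ℝ} {N : ℝ≥0∞}
    (h1 : ContDiff ℝ ∞ χ) (h2 : HasCompactSupport χ) (h3 : tsupport χ ⊆ U)
    (hB : ∀ i ≤ m, ∀ x, |iteratedDeriv i χ x| ≤ B)
    (hv : ∀ j ≤ m, LocallyIntegrableOn (v j) U)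
    (hN : ∀ j ≤ m, eLpNorm (v j) p (volume.restrict U) ≤ N) :
    eLpNorm (leibnizSum m χ v) p volume ≤ 2 ^ m * (ENNReal.ofReal B * N) := by
  induction m generalizing χ v with
  | zero =>
    have hz : leibnizSum 0 χ v = U.indicator (fun x => χ x * v 0 x) := by
      funext x
      by_cases hx : x ∈ U
      · simp [leibnizSum, hx]
      · rw [indicator_of_notMem hx]
        exact leibnizSum_eq_zero 0 χ v (fun h => hx (h3 h))
    rw [hz, eLpNorm_indicator_eq_eLpNorm_restrict hU, pow_zero, one_mul]
    refine (eLpNorm_le_mul_eLpNorm_of_ae_le_mul (g := v 0) (c := B)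
      (Eventually.of_forall fun x => ?_) p).trans (mul_le_mul_right (hN 0 le_rfl) _)
    rw [norm_mul]
    exact mul_le_mul_of_nonneg_right (by simpa using hB 0 le_rfl x) (norm_nonneg _)
  | succ m ih =>
    have hχ' := (contDiff_infty_iff_deriv.mp h1).2
    have h3' := (tsupport_deriv_subset (f := χ)).trans h3
    have a1 := ih hχ' h2.deriv h3'
      (fun i hi x => by rw [← iteratedDeriv_succ']; exact hB (i + 1) (by omega) x)
      (fun j hj => hv j (by omega)) (fun j hj => hN j (by omega))
    have a2 := ih h1 h2 h3 (fun i hi x => hB i (by omega) x)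
      (fun j hj => hv (j + 1) (by omega)) (fun j hj => hN (j + 1) (by omega))
    have i1 := (integrable_leibnizSum m hχ' h2.deriv h3'
      (fun j hj => hv j (by omega))).aestronglyMeasurable
    have i2 := (integrable_leibnizSum m h1 h2 h3
      (fun j hj => hv (j + 1) (by omega))).aestronglyMeasurable
    refine (eLpNorm_add_le i1 i2 hp).trans ((add_le_add a1 a2).trans (le_of_eq ?_))
    ring

/-! ### Cauchy's formula for repeated integration -/

/-- The fundamental solution `s₊ⁿ / n!` of `D ^ (n + 1)` on the line. -/
noncomputable def cauchyKernel (n : ℕ) (s : ℝ) : ℝ :=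
  (Ioi (0 : ℝ)).indicator (fun s => s ^ n / (n.factorial : ℝ)) s

theorem cauchyKernel_of_pos (n : ℕ) {s : ℝ} (hs : 0 < s) :
    cauchyKernel n s = s ^ n / (n.factorial : ℝ) := indicator_of_mem hs _

theorem cauchyKernel_of_nonpos (n : ℕ) {s : ℝ} (hs : s ≤ 0) : cauchyKernel n s = 0 :=
  indicator_of_notMem (not_lt.mpr hs) _

theorem measurable_cauchyKernel (n : ℕ) : Measurable (cauchyKernel n) :=
  Measurable.indicator (by fun_prop) measurableSet_Ioi

theorem abs_cauchyKernel_le (n : ℕ) (s : ℝ) :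
    |cauchyKernel n s| ≤ |s| ^ n / (n.factorial : ℝ) := by
  rcases lt_or_ge 0 s with h | h
  · rw [cauchyKernel_of_pos n h, abs_div, abs_pow, Nat.abs_cast]
  · rw [cauchyKernel_of_nonpos n h, abs_zero]
    positivity

/-- For `φ` of compact support: up to sign, the `(n + 1)`-fold primitive of `φ` which vanishes near
`+∞`. -/
noncomputable def iteratedPrimitive (n : ℕ) (φ : ℝ → ℝ) (t : ℝ) : ℝ :=
  ∫ s, cauchyKernel n s * φ (t + s)

theorem iteratedPrimitive_eq_convolution (n : ℕ) (φ : ℝ → ℝ) :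
    iteratedPrimitive n φ = convolution (fun s => cauchyKernel n (-s)) φ
      (ContinuousLinearMap.mul ℝ ℝ) volume := by
  funext t
  rw [convolution_def, iteratedPrimitive,
    ← integral_neg_eq_self (fun s => cauchyKernel n s * φ (t + s))]
  simp [sub_eq_add_neg]

theorem locallyIntegrable_cauchyKernel_neg (n : ℕ) :
    LocallyIntegrable (fun s => cauchyKernel n (-s)) := by
  have : (fun s => cauchyKernel n (-s))
      = (Iio (0 : ℝ)).indicator (fun s => (-s) ^ n / (n.factorial : ℝ)) := by
    funext s
    by_cases hs : s < 0
    · rw [indicator_of_mem (show s ∈ Iio (0 : ℝ) from hs), cauchyKernel_of_pos n (by linarith)]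
    · rw [indicator_of_notMem (show s ∉ Iio (0 : ℝ) from hs),
        cauchyKernel_of_nonpos n (by linarith)]
  rw [this]
  exact LocallyIntegrable.indicator
    (Continuous.locallyIntegrable (by fun_prop)) measurableSet_Iio

theorem contDiff_iteratedPrimitive (n : ℕ) {φ : ℝ → ℝ} (h1 : ContDiff ℝ ∞ φ)
    (h2 : HasCompactSupport φ) : ContDiff ℝ ∞ (iteratedPrimitive n φ) := by
  rw [iteratedPrimitive_eq_convolution]
  exact h2.contDiff_convolution_right _ (locallyIntegrable_cauchyKernel_neg n) h1

theorem deriv_iteratedPrimitive (n : ℕ) {φ : ℝ → ℝ} (h1 : ContDiff ℝ ∞ φ)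
    (h2 : HasCompactSupport φ) :
    deriv (iteratedPrimitive n φ) = iteratedPrimitive n (deriv φ) := by
  funext t
  rw [iteratedPrimitive_eq_convolution, iteratedPrimitive_eq_convolution]
  exact (h2.hasDerivAt_convolution_right _ (locallyIntegrable_cauchyKernel_neg n)
    (h1.of_le (by exact_mod_cast le_top)) t).deriv

theorem iteratedPrimitive_eq_setIntegral (n : ℕ) (φ : ℝ → ℝ) (t : ℝ) :
    iteratedPrimitive n φ t = ∫ s in Ioi (0 : ℝ), s ^ n / (n.factorial : ℝ) * φ (t + s) := by
  rw [iteratedPrimitive, ← integral_indicator measurableSet_Ioi]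
  refine integral_congr_ae (Eventually.of_forall fun s => ?_)
  by_cases hs : s ∈ Ioi (0 : ℝ) <;> simp [cauchyKernel, hs]

/-- Integration by parts against a compactly supported function on a half-line. -/
theorem integral_Ioi_mul_deriv_of_hasCompactSupport {u u' φ : ℝ → ℝ}
    (hu : ∀ s, HasDerivAt u (u' s) s) (hu' : Continuous u') (h1 : ContDiff ℝ ∞ φ)
    (h2 : HasCompactSupport φ) (t : ℝ) :
    ∫ s in Ioi (0 : ℝ), u s * deriv φ (t + s)
      = -(u 0 * φ t) - ∫ s in Ioi (0 : ℝ), u' s * φ (t + s) := by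
  have hc : Continuous u := continuous_iff_continuousAt.mpr fun s => (hu s).continuousAt
  have hs : ∀ ψ : ℝ → ℝ, HasCompactSupport ψ → HasCompactSupport fun s => ψ (t + s) :=
    fun ψ hψ => hψ.comp_homeomorph (Homeomorph.addLeft t)
  have hd : ∀ s, HasDerivAt (fun s => φ (t + s)) (deriv φ (t + s)) s := fun s => by
    have h := ((h1.differentiable (by simp)) (t + s)).hasDerivAt
    exact h.comp_const_add t s
  have hcd : Continuous (deriv φ) := (contDiff_infty_iff_deriv.mp h1).2.continuous
  have hinf : Tendsto (u * fun s => φ (t + s)) atTop (𝓝 0) := by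
    have h3 : HasCompactSupport (u * fun s => φ (t + s)) := (hs φ h2).mul_left
    have := h3.is_zero_at_infty
    exact this.mono_left atTop_le_cocompact
  have hzero : Tendsto (u * fun s => φ (t + s)) (𝓝[>] 0) (𝓝 (u 0 * φ t)) := by
    have h3 : Continuous (u * fun s => φ (t + s)) :=
      hc.mul (h1.continuous.comp (continuous_const.add continuous_id))
    have := (h3.tendsto 0).mono_left (nhdsWithin_le_nhds (s := Ioi 0))
    simpa using this
  have h := integral_Ioi_mul_deriv_eq_deriv_mul (fun s _ => hu s) (fun s _ => hd s)
    ((hc.mul (hcd.comp (continuous_const.add continuous_id))).integrable_of_hasCompactSupport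
      ((hs _ h2.deriv).mul_left)).integrableOn
    ((hu'.mul (h1.continuous.comp
      (continuous_const.add continuous_id))).integrable_of_hasCompactSupport
      ((hs _ h2).mul_left)).integrableOn hzero hinf
  rw [h]
  ring

theorem iteratedPrimitive_zero_deriv {φ : ℝ → ℝ} (h1 : ContDiff ℝ ∞ φ)
    (h2 : HasCompactSupport φ) (t : ℝ) : iteratedPrimitive 0 (deriv φ) t = -φ t := by
  have h := integral_Ioi_mul_deriv_of_hasCompactSupport (u := fun _ => 1) (u' := fun _ => 0)
    (fun s => hasDerivAt_const s 1) continuous_const h1 h2 t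
  rw [iteratedPrimitive_eq_setIntegral]
  simpa using h

theorem iteratedPrimitive_succ_deriv (n : ℕ) {φ : ℝ → ℝ} (h1 : ContDiff ℝ ∞ φ)
    (h2 : HasCompactSupport φ) (t : ℝ) :
    iteratedPrimitive (n + 1) (deriv φ) t = -iteratedPrimitive n φ t := by
  have h := integral_Ioi_mul_deriv_of_hasCompactSupport
    (u := fun s => s ^ (n + 1) / ((n + 1).factorial : ℝ)) (u' := fun s => s ^ n / (n.factorial : ℝ))
    (fun s => by
      have := (hasDerivAt_pow (n + 1) s).div_const ((n + 1).factorial : ℝ)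
      refine this.congr_deriv ?_
      rw [Nat.factorial_succ]
      push_cast
      have h3 : (n.factorial : ℝ) ≠ 0 := by exact_mod_cast n.factorial_ne_zero
      have h4 : (n : ℝ) + 1 ≠ 0 := by positivity
      field_simp) (by fun_prop) h1 h2 t
  rw [iteratedPrimitive_eq_setIntegral, iteratedPrimitive_eq_setIntegral]
  simpa using h

theorem iteratedDeriv_iteratedPrimitive (n : ℕ) {φ : ℝ → ℝ} (h1 : ContDiff ℝ ∞ φ)
    (h2 : HasCompactSupport φ) (t : ℝ) :
    iteratedDeriv (n + 1) (iteratedPrimitive n φ) t = (-1) ^ (n + 1) * φ t := by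
  induction n with
  | zero =>
    rw [zero_add, iteratedDeriv_one, deriv_iteratedPrimitive 0 h1 h2,
      iteratedPrimitive_zero_deriv h1 h2]
    ring
  | succ n ih =>
    rw [iteratedDeriv_succ', deriv_iteratedPrimitive (n + 1) h1 h2]
    have e : iteratedPrimitive (n + 1) (deriv φ) = fun t => -iteratedPrimitive n φ t :=
      funext (iteratedPrimitive_succ_deriv n h1 h2)
    rw [e, iteratedDeriv_fun_neg, ih]
    ring

theorem integral_cauchyKernel_sub_mul (n : ℕ) (φ : ℝ → ℝ) (t : ℝ) :
    ∫ x, cauchyKernel n (x - t) * φ x = iteratedPrimitive n φ t := by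
  rw [iteratedPrimitive,
    ← integral_sub_right_eq_self (fun s => cauchyKernel n s * φ (t + s)) t]
  simp

theorem integral_cauchyKernel_mul_sub (n : ℕ) (h : ℝ → ℝ) (x : ℝ) :
    ∫ s, cauchyKernel n s * h (x - s) = ∫ t, cauchyKernel n (x - t) * h t := by
  rw [← integral_sub_left_eq_self (fun s => cauchyKernel n s * h (x - s)) volume x]
  simp

theorem abs_cauchyKernel_sub_le (n : ℕ) {B S x t : ℝ} (hx : |x| ≤ B) (ht : |t| ≤ S) :
    |cauchyKernel n (x - t)| ≤ (B + S) ^ n / (n.factorial : ℝ) := by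
  refine (abs_cauchyKernel_le n _).trans ?_
  have : |x - t| ≤ B + S := (abs_sub x t).trans (add_le_add hx ht)
  gcongr

theorem integrable_mul_cauchyKernel_sub_mul (n : ℕ) {ν : Measure ℝ} [SFinite ν] {ψ h : ℝ → ℝ}
    (hψ : Integrable ψ ν)
    (hh : Integrable h) {B S : ℝ} (hB : ∀ x, B < |x| → ψ x = 0) (hS : ∀ x, S < |x| → h x = 0) :
    Integrable (fun q : ℝ × ℝ => ψ q.1 * (cauchyKernel n (q.1 - q.2) * h q.2))
      (ν.prod volume) := by
  have hm := (hψ.mul_prod hh).const_mul ((B + S) ^ n / (n.factorial : ℝ))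
  refine hm.mono ?_ (Eventually.of_forall fun q => ?_)
  · exact hψ.aestronglyMeasurable.comp_fst.mul
      (((measurable_cauchyKernel n).comp
        (measurable_fst.sub measurable_snd)).aestronglyMeasurable.mul hh.aestronglyMeasurable.comp_snd)
  · by_cases h1 : B < |q.1|
    · simp [hB _ h1]
    by_cases h2 : S < |q.2|
    · simp [hS _ h2]
    have h3 := abs_cauchyKernel_sub_le n (not_lt.mp h1) (not_lt.mp h2)
    simp only [norm_mul, Real.norm_eq_abs]
    have h4 : |cauchyKernel n (q.1 - q.2)| ≤ |(B + S) ^ n / (n.factorial : ℝ)| :=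
      h3.trans (le_abs_self _)
    calc _ = |cauchyKernel n (q.1 - q.2)| * (|ψ q.1| * |h q.2|) := by ring
      _ ≤ _ := mul_le_mul_of_nonneg_right h4 (by positivity)

/-- A function with compactly supported weak derivative `h` of order `n + 1` on the whole line, and
itself compactly supported, is recovered from `h` by convolution with `cauchyKernel n`. That `g` has
compact support is encoded by allowing test functions without compact support. -/
theorem ae_eq_integral_cauchyKernel_mul (n : ℕ) {g h : ℝ → ℝ} (hg : Integrable g)
    (hh : Integrable h) {S : ℝ} (hS : ∀ x, S < |x| → h x = 0)
    (hgh : ∀ Φ : ℝ → ℝ, ContDiff ℝ ∞ Φ →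
      ∫ x, h x * Φ x = (-1) ^ (n + 1) * ∫ x, g x * iteratedDeriv (n + 1) Φ x) :
    ∀ᵐ x, g x = ∫ s, cauchyKernel n s * h (x - s) := by
  simp_rw [integral_cauchyKernel_mul_sub]
  refine ae_eq_of_integral_contDiff_smul_eq hg.locallyIntegrable ?_ ?_
  · rw [locallyIntegrable_iff]
    intro K hK
    obtain ⟨B, hB⟩ := hK.isBounded.subset_closedBall 0
    have : IsFiniteMeasure (volume.restrict K) := ⟨by simpa using hK.measure_lt_top⟩
    have hi := (integrable_mul_cauchyKernel_sub_mul n (ν := volume.restrict K)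
      (ψ := (Metric.closedBall (0 : ℝ) B).indicator fun _ => 1) (B := B)
      ((integrable_const _).indicator Metric.isClosed_closedBall.measurableSet) hh
      (fun x hx => indicator_of_notMem (by simpa using hx) _) hS).integral_prod_left
    refine hi.congr ?_
    filter_upwards [ae_restrict_mem hK.measurableSet] with x hx
    simp [hB hx]
  · intro φ h1 h2
    obtain ⟨B, hB⟩ := h2.isCompact.isBounded.subset_closedBall 0
    have hi := integrable_mul_cauchyKernel_sub_mul n (ν := volume) (ψ := φ) (B := B)
      (h1.continuous.integrable_of_hasCompactSupport h2) hh
      (fun x hx => image_eq_zero_of_notMem_tsupport fun h => by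
        have := hB h
        simp at this
        linarith) hS
    simp only [smul_eq_mul]
    calc ∫ x, φ x * g x
        = (-1) ^ (n + 1) * ∫ x, g x * iteratedDeriv (n + 1) (iteratedPrimitive n φ) x := by
          simp_rw [iteratedDeriv_iteratedPrimitive n h1 h2]
          rw [← integral_const_mul]
          refine integral_congr_ae (Eventually.of_forall fun x => ?_)
          have : ((-1 : ℝ) ^ (n + 1)) * (-1) ^ (n + 1) = 1 := by
            rw [← mul_pow]; norm_num
          linear_combination (- φ x * g x) * this
      _ = ∫ t, h t * iteratedPrimitive n φ t :=
          (hgh _ (contDiff_iteratedPrimitive n h1 h2)).symm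
      _ = ∫ t, ∫ x, φ x * (cauchyKernel n (x - t) * h t) := by
          refine integral_congr_ae (Eventually.of_forall fun t => ?_)
          simp only
          rw [← integral_cauchyKernel_sub_mul, ← integral_const_mul]
          exact integral_congr_ae (Eventually.of_forall fun x => by ring)
      _ = ∫ x, ∫ t, φ x * (cauchyKernel n (x - t) * h t) := (integral_integral_swap hi).symm
      _ = ∫ x, φ x * ∫ t, cauchyKernel n (x - t) * h t := by
          simp_rw [integral_const_mul]

/-! ### The residual kernel -/

/-- The convolution of `cauchyKernel n` with `δ - k`, where `δ` is the Dirac mass at `0`. Its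
distributional derivative of order `n + 1` is `δ - k`. -/
noncomputable def residualKernel (n : ℕ) (k : ℝ → ℂ) (s : ℝ) : ℂ :=
  (cauchyKernel n s : ℂ) - ∫ y, k y * (cauchyKernel n (s - y) : ℂ)

theorem integral_indicator_Ioi_inv_sq {ε r : ℝ} (hε : 0 < ε) (hr : 0 ≤ r) :
    ∫ y, (Ioi r).indicator (fun y => ((ε + y) ^ 2)⁻¹) |y| = 2 * (ε + r)⁻¹ := by
  rw [integral_comp_abs (f := (Ioi r).indicator (fun y => ((ε + y) ^ 2)⁻¹)),
    setIntegral_indicator measurableSet_Ioi, Ioi_inter_Ioi, sup_eq_right.mpr hr]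
  congr 1
  have hd : ∀ x ∈ Ici r, HasDerivAt (fun y => -(ε + y)⁻¹) (((ε + x) ^ 2)⁻¹) x := fun x hx => by
    have hx' : r ≤ x := hx
    have := (((hasDerivAt_id x).const_add ε).inv (by simp; linarith)).neg
    refine this.congr_deriv ?_
    simp [neg_div, one_div]
  have hl : Tendsto (fun y : ℝ => -(ε + y)⁻¹) atTop (𝓝 0) := by
    have : Tendsto (fun y : ℝ => (ε + y)⁻¹) atTop (𝓝 0) :=
      tendsto_inv_atTop_zero.comp (tendsto_atTop_add_const_left _ ε tendsto_id)
    simpa using this.neg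
  rw [integral_Ioi_of_hasDerivAt_of_nonneg' hd (fun x _ => by positivity) hl]
  simp

theorem integrable_indicator_Ioi_inv_sq {ε r : ℝ} (hε : 0 < ε) (hr : 0 ≤ r) :
    Integrable (fun y : ℝ => (Ioi r).indicator (fun y => ((ε + y) ^ 2)⁻¹) |y|) := by
  -- a function with nonzero Bochner integral is integrable
  refine Integrable.of_integral_ne_zero ?_
  rw [integral_indicator_Ioi_inv_sq hε hr]
  positivity

section
variable {n : ℕ} {k : ℝ → ℂ} {A ε : ℝ}

theorem norm_mul_abs_pow_le (hε : 0 < ε) (hA : 0 ≤ A)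
    (hk : ∀ y, ‖k y‖ ≤ A / (ε + |y|) ^ (n + 2)) (y : ℝ) :
    ‖k y‖ * |y| ^ n ≤ A * ((ε + |y|) ^ 2)⁻¹ := by
  have h0 : 0 < ε + |y| := by positivity
  have h1 : |y| ^ n ≤ (ε + |y|) ^ n := by gcongr; linarith
  calc ‖k y‖ * |y| ^ n ≤ A / (ε + |y|) ^ (n + 2) * (ε + |y|) ^ n := by
        gcongr
        exact hk y
    _ = A * ((ε + |y|) ^ 2)⁻¹ := by
        rw [pow_add]
        field_simp

theorem integrable_norm_mul_abs_pow (hε : 0 < ε) (hA : 0 ≤ A)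
    (hk : ∀ y, ‖k y‖ ≤ A / (ε + |y|) ^ (n + 2)) (hi : Integrable k) :
    Integrable (fun y => ‖k y‖ * |y| ^ n) := by
  have h := (integrable_indicator_Ioi_inv_sq hε le_rfl).const_mul A
  refine h.mono (hi.aestronglyMeasurable.norm.mul
    (Continuous.aestronglyMeasurable (by fun_prop))) ?_
  have h0 : ∀ᵐ y : ℝ, y ≠ 0 := by simp [ae_iff]
  filter_upwards [h0] with y hy
  rw [indicator_of_mem (show |y| ∈ Ioi (0 : ℝ) from abs_pos.mpr hy),
    Real.norm_of_nonneg (by positivity)]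
  exact (norm_mul_abs_pow_le hε hA hk y).trans (le_abs_self _)

theorem integrable_norm_mul_add_abs_pow (hε : 0 < ε) (hA : 0 ≤ A)
    (hk : ∀ y, ‖k y‖ ≤ A / (ε + |y|) ^ (n + 2)) (hi : Integrable k) {T : ℝ} (hT : 0 ≤ T) :
    Integrable (fun y => ‖k y‖ * (T + |y|) ^ n) := by
  have h := ((hi.norm.mul_const (T ^ n)).add
    (integrable_norm_mul_abs_pow hε hA hk hi)).const_mul (2 ^ (n - 1))
  refine h.mono (hi.aestronglyMeasurable.norm.mul
    (Continuous.aestronglyMeasurable (by fun_prop))) (Eventually.of_forall fun y => ?_)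
  rw [Real.norm_of_nonneg (by positivity)]
  refine le_trans ?_ (le_abs_self _)
  have := add_pow_le hT (abs_nonneg y) n
  calc ‖k y‖ * (T + |y|) ^ n ≤ ‖k y‖ * (2 ^ (n - 1) * (T ^ n + |y| ^ n)) := by gcongr
    _ = _ := by simp only [Pi.add_apply]; ring

theorem integrable_mul_cauchyKernel (hε : 0 < ε) (hA : 0 ≤ A)
    (hk : ∀ y, ‖k y‖ ≤ A / (ε + |y|) ^ (n + 2)) (hi : Integrable k) (s : ℝ) :
    Integrable (fun y => k y * (cauchyKernel n (s - y) : ℂ)) := by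
  have h := (integrable_norm_mul_add_abs_pow hε hA hk hi (abs_nonneg s)).mul_const
    ((n.factorial : ℝ)⁻¹)
  refine h.mono (hi.aestronglyMeasurable.mul (Complex.measurable_ofReal.comp
    ((measurable_cauchyKernel n).comp
      (measurable_const.sub measurable_id))).aestronglyMeasurable) (Eventually.of_forall fun y => ?_)
  have h1 := abs_cauchyKernel_sub_le n (le_refl |s|) (le_refl |y|)
  rw [norm_mul, Complex.norm_real, Real.norm_eq_abs, Real.norm_of_nonneg (by positivity)]
  calc _ ≤ ‖k y‖ * ((|s| + |y|) ^ n / (n.factorial : ℝ)) := by gcongr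
    _ = _ := by ring

/-- The vanishing moments of `k` say that `k` reproduces polynomials of degree at most `n`. -/
theorem integral_mul_sub_pow (hi : Integrable k) (h1 : ∫ y, k y = 1)
    (hmom : ∀ j : ℕ, 0 < j → j < n + 1 →
      Integrable (fun x : ℝ => k x * (x : ℂ) ^ j) ∧ ∫ x : ℝ, k x * (x : ℂ) ^ j = 0) (s : ℝ) :
    Integrable (fun y : ℝ => k y * ((s : ℂ) - y) ^ n) ∧
      ∫ y : ℝ, k y * ((s : ℂ) - y) ^ n = (s : ℂ) ^ n := by
  have e : ∀ y : ℝ, k y * ((s : ℂ) - y) ^ n = ∑ j ∈ Finset.range (n + 1),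
      (k y * (y : ℂ) ^ j) * ((-1) ^ j * (s : ℂ) ^ (n - j) * (n.choose j : ℂ)) := fun y => by
    rw [show (s : ℂ) - y = -y + s by ring, add_pow, Finset.mul_sum]
    refine Finset.sum_congr rfl fun j _ => ?_
    rw [neg_pow]
    ring
  have hint : ∀ j ∈ Finset.range (n + 1), Integrable (fun y : ℝ =>
      (k y * (y : ℂ) ^ j) * ((-1) ^ j * (s : ℂ) ^ (n - j) * (n.choose j : ℂ))) := fun j hj => by
    refine Integrable.mul_const ?_ _
    rcases Nat.eq_zero_or_pos j with rfl | hj0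
    · simpa using hi
    · exact (hmom j hj0 (Finset.mem_range.mp hj)).1
  simp_rw [e]
  refine ⟨integrable_finsetSum _ hint, ?_⟩
  rw [integral_finsetSum _ hint, Finset.sum_eq_single_of_mem 0 (by simp)]
  · simp [integral_mul_const, h1]
  · intro j hj hj0
    rw [integral_mul_const, (hmom j (Nat.pos_of_ne_zero hj0) (Finset.mem_range.mp hj)).2, zero_mul]

/-- Decay of the residual kernel. On the negative half-line only `y < s` contributes to its
defining integral; on the positive half-line the moments of `k` turn the residual kernel into an integral over `y > s`. In
both cases `|s - y| ≤ |y|`, and the decay of `k` leaves an integrand of size `(ε + |y|)⁻²`. -/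
theorem norm_residualKernel_le (hε : 0 < ε) (hA : 0 ≤ A)
    (hk : ∀ y, ‖k y‖ ≤ A / (ε + |y|) ^ (n + 2)) (hi : Integrable k) (h1 : ∫ y, k y = 1)
    (hmom : ∀ j : ℕ, 0 < j → j < n + 1 →
      Integrable (fun x : ℝ => k x * (x : ℂ) ^ j) ∧ ∫ x : ℝ, k x * (x : ℂ) ^ j = 0) (s : ℝ) :
    ‖residualKernel n k s‖ ≤ 2 * A / (n.factorial : ℝ) / (ε + |s|) := by
  have hf : (0 : ℝ) < n.factorial := by exact_mod_cast n.factorial_pos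
  have hI := (integrable_indicator_Ioi_inv_sq hε (abs_nonneg s)).const_mul
    (A / (n.factorial : ℝ))
  have hval : ∫ y, A / (n.factorial : ℝ) * (Ioi |s|).indicator (fun y => ((ε + y) ^ 2)⁻¹) |y|
      = 2 * A / (n.factorial : ℝ) / (ε + |s|) := by
    rw [integral_const_mul, integral_indicator_Ioi_inv_sq hε (abs_nonneg s)]
    field_simp
  rw [← hval]
  have hne : ∀ᵐ y : ℝ, y ≠ s := by simp [ae_iff]
  -- only the `y` on the far side of `s`, seen from the origin, contribute
  have hmain : ∀ y : ℝ, |s| < |y| → |s - y| ≤ |y| → ‖k y‖ * (|s - y| ^ n / (n.factorial : ℝ)) ≤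
      A / (n.factorial : ℝ) * (Ioi |s|).indicator (fun y => ((ε + y) ^ 2)⁻¹) |y| := by
    intro y hy hsy
    rw [indicator_of_mem (show |y| ∈ Ioi |s| from hy)]
    have h2 := norm_mul_abs_pow_le hε hA hk y
    calc ‖k y‖ * (|s - y| ^ n / (n.factorial : ℝ)) ≤ ‖k y‖ * (|y| ^ n / (n.factorial : ℝ)) := by
          gcongr
      _ = (‖k y‖ * |y| ^ n) / (n.factorial : ℝ) := by ring
      _ ≤ (A * ((ε + |y|) ^ 2)⁻¹) / (n.factorial : ℝ) := by gcongr
      _ = _ := by ring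
  have hnn : ∀ y : ℝ,
      0 ≤ A / (n.factorial : ℝ) * (Ioi |s|).indicator (fun y => ((ε + y) ^ 2)⁻¹) |y| := fun y =>
    mul_nonneg (by positivity) (indicator_nonneg (fun z _ => by positivity) _)
  rcases le_or_gt s 0 with hs | hs
  · rw [residualKernel, cauchyKernel_of_nonpos n hs, Complex.ofReal_zero, zero_sub, norm_neg]
    refine norm_integral_le_of_norm_le hI ?_
    filter_upwards with y
    rw [norm_mul, Complex.norm_real, Real.norm_eq_abs]
    rcases lt_or_ge y s with hy | hy
    · refine le_trans ?_ (hmain y ?_ ?_)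
      · gcongr
        exact abs_cauchyKernel_le n _
      · rw [abs_of_nonpos hs, abs_of_neg (by linarith)]; linarith
      · rw [abs_of_pos (by linarith), abs_of_neg (by linarith)]; linarith
    · rw [cauchyKernel_of_nonpos n (by linarith), abs_zero, mul_zero]
      exact hnn y
  · obtain ⟨i1, i2⟩ := integral_mul_sub_pow hi h1 hmom s
    have e : residualKernel n k s = ∫ y : ℝ, (k y * ((s : ℂ) - y) ^ n / (n.factorial : ℂ)
        - k y * (cauchyKernel n (s - y) : ℂ)) := by
      rw [integral_sub (i1.div_const _) (integrable_mul_cauchyKernel hε hA hk hi s),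
        integral_div, i2, residualKernel, cauchyKernel_of_pos n hs]
      push_cast
      rfl
    rw [e]
    refine norm_integral_le_of_norm_le hI ?_
    filter_upwards [hne] with y hys
    rcases lt_or_ge y s with hy | hy
    · rw [cauchyKernel_of_pos n (by linarith)]
      push_cast
      rw [mul_div_assoc, sub_self, norm_zero]
      exact hnn y
    · rw [cauchyKernel_of_nonpos n (by linarith), Complex.ofReal_zero, mul_zero, sub_zero]
      have hy' : s < y := lt_of_le_of_ne hy hys.symm
      refine le_trans (le_of_eq ?_) (hmain y ?_ ?_)
      · rw [norm_div, norm_mul, norm_pow, ← Complex.ofReal_sub, Complex.norm_real,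
          Complex.norm_natCast, Real.norm_eq_abs]
        ring
      · rw [abs_of_pos hs, abs_of_pos (by linarith)]; exact hy'
      · rw [abs_of_neg (by linarith), abs_of_pos (by linarith)]; linarith

/-- The error of the approximation by `k` is the convolution of the derivative of order `n + 1` with
the residual kernel. -/
theorem sub_integral_eq_integral_residualKernel (hε : 0 < ε) (hA : 0 ≤ A)
    (hk : ∀ y, ‖k y‖ ≤ A / (ε + |y|) ^ (n + 2)) (hi : Integrable k) {g h : ℝ → ℝ}
    (hh : Integrable h) {S : ℝ} (hS : ∀ x, S < |x| → h x = 0)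
    (hg : ∀ᵐ x, g x = ∫ s, cauchyKernel n s * h (x - s)) {x : ℝ}
    (hx : g x = ∫ s, cauchyKernel n s * h (x - s)) :
    (g x : ℂ) - ∫ y, k y * (g (x - y) : ℂ) = ∫ s, residualKernel n k s * (h (x - s) : ℂ) := by
  set T := |x| + |S|
  have hT : ∀ s, T < |s| → h (x - s) = 0 := fun s hs => hS _ (by
    have h1 : |s| - |x| ≤ |x - s| := by
      rw [abs_sub_comm]; exact abs_sub_abs_le_abs_sub s x
    have h2 := le_abs_self S
    simp only [T] at hs
    linarith)
  have hT0 : 0 ≤ T := by positivity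
  have hhx : Integrable fun s => h (x - s) := hh.comp_sub_left x
  have hcm := measurable_cauchyKernel n
  have hprod : Integrable (fun q : ℝ × ℝ =>
      (k q.1 * (cauchyKernel n (q.2 - q.1) : ℂ)) * (h (x - q.2) : ℂ)) (volume.prod volume) := by
    have hm := ((integrable_norm_mul_add_abs_pow hε hA hk hi hT0).mul_prod hhx.norm).mul_const
      ((n.factorial : ℝ)⁻¹)
    refine hm.mono ?_ (Eventually.of_forall fun q => ?_)
    · exact (hi.aestronglyMeasurable.comp_fst.mul (Complex.measurable_ofReal.comp
        (hcm.comp (measurable_snd.sub measurable_fst))).aestronglyMeasurable).mul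
        (hhx.ofReal.aestronglyMeasurable (μ := volume) |>.comp_snd)
    · rw [norm_mul, norm_mul, Complex.norm_real, Complex.norm_real,
        Real.norm_eq_abs (cauchyKernel n _)]
      refine le_trans ?_ (le_abs_self _)
      by_cases hq : T < |q.2|
      · rw [hT _ hq, norm_zero]
        simp
      · have h1 := abs_cauchyKernel_sub_le n (not_lt.mp hq) (le_refl |q.1|)
        calc _ ≤ ‖k q.1‖ * ((T + |q.1|) ^ n / (n.factorial : ℝ)) * ‖h (x - q.2)‖ := by gcongr
          _ = _ := by ring
  have hshift : ∀ y, (∫ s, cauchyKernel n s * h (x - y - s))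
      = ∫ s, cauchyKernel n (s - y) * h (x - s) := fun y => by
    rw [← integral_sub_right_eq_self (fun s => cauchyKernel n s * h (x - y - s)) y]
    refine integral_congr_ae (Eventually.of_forall fun s => ?_)
    simp only
    congr 2
    ring
  have hgx : ∀ᵐ y, g (x - y) = ∫ s, cauchyKernel n s * h (x - y - s) :=
    (quasiMeasurePreserving_sub_left (volume : Measure ℝ) x).ae hg
  have e1 : ∫ y, k y * (g (x - y) : ℂ)
      = ∫ s, (∫ y, k y * (cauchyKernel n (s - y) : ℂ)) * (h (x - s) : ℂ) := by
    calc ∫ y, k y * (g (x - y) : ℂ)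
        = ∫ y, ∫ s, (k y * (cauchyKernel n (s - y) : ℂ)) * (h (x - s) : ℂ) := by
          refine integral_congr_ae ?_
          filter_upwards [hgx] with y hy
          rw [hy, hshift, ← integral_complex_ofReal, ← integral_const_mul]
          refine integral_congr_ae (Eventually.of_forall fun s => ?_)
          simp only
          push_cast
          ring
      _ = ∫ s, ∫ y, (k y * (cauchyKernel n (s - y) : ℂ)) * (h (x - s) : ℂ) :=
          integral_integral_swap hprod
      _ = _ := by simp_rw [integral_mul_const]
  have i1 : Integrable fun s => (cauchyKernel n s : ℂ) * (h (x - s) : ℂ) := by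
    have hm := hhx.norm.mul_const (T ^ n / (n.factorial : ℝ))
    refine hm.mono ((Complex.measurable_ofReal.comp hcm).aestronglyMeasurable.mul
      hhx.ofReal.aestronglyMeasurable) (Eventually.of_forall fun s => ?_)
    rw [norm_mul, Complex.norm_real, Complex.norm_real, Real.norm_eq_abs (cauchyKernel n _)]
    refine le_trans ?_ (le_abs_self _)
    by_cases hq : T < |s|
    · rw [hT _ hq, norm_zero]
      simp
    · have h1 := abs_cauchyKernel_sub_le n (not_lt.mp hq) (abs_zero (α := ℝ)).le
      rw [sub_zero, add_zero] at h1
      rw [mul_comm]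
      gcongr
  have i2 : Integrable fun s =>
      (∫ y, k y * (cauchyKernel n (s - y) : ℂ)) * (h (x - s) : ℂ) := by
    have := hprod.integral_prod_right
    simpa only [integral_mul_const] using this
  rw [e1, hx, ← integral_complex_ofReal]
  simp only [Complex.ofReal_mul]
  rw [← integral_sub i1 i2]
  refine integral_congr_ae (Eventually.of_forall fun s => ?_)
  simp only [residualKernel]
  ring

end

/-! ### Young's inequality and the logarithm -/

/-- Young's inequality `‖ν * h‖_p ≤ ‖ν‖ ‖h‖_p` for the convolution with a finite measure. -/
theorem eLpNorm_le_of_enorm_le_lintegral_sub {p : ℝ≥0∞} (hp : 1 ≤ p) (hp' : p ≠ ⊤)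
    {ν τ : Measure ℝ} [IsFiniteMeasure ν] (hν : ν ≪ volume) (hτ : τ ≤ volume) {h : ℝ → ℝ}
    (hh : AEStronglyMeasurable h) {F : ℝ → ℂ}
    (hF : ∀ᵐ x ∂τ, ‖F x‖ₑ ≤ ∫⁻ s, ‖h (x - s)‖ₑ ∂ν) :
    eLpNorm F p τ ≤ ν univ * eLpNorm h p volume := by
  have hp0 : p ≠ 0 := (zero_lt_one.trans_le hp).ne'
  have hr : 0 < p.toReal := ENNReal.toReal_pos hp0 hp'
  have hr1 : 1 ≤ p.toReal := by
    have := (ENNReal.toReal_le_toReal ENNReal.one_ne_top hp').mpr hp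
    simpa using this
  set r := p.toReal
  have hslice : ∀ x, (∫⁻ s, ‖h (x - s)‖ₑ ∂ν) ^ r
      ≤ (∫⁻ s, ‖h (x - s)‖ₑ ^ r ∂ν) * ν univ ^ (r - 1) := fun x => by
    have hm : AEStronglyMeasurable (fun s => h (x - s)) ν :=
      (hh.comp_quasiMeasurePreserving
        (quasiMeasurePreserving_sub_left (volume : Measure ℝ) x)).mono_ac hν
    have := eLpNorm_le_eLpNorm_mul_rpow_measure_univ hp hm
    rw [eLpNorm_one_eq_lintegral_enorm, eLpNorm_eq_lintegral_rpow_enorm_toReal hp0 hp'] at this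
    refine (ENNReal.rpow_le_rpow this hr.le).trans (le_of_eq ?_)
    rw [ENNReal.mul_rpow_of_nonneg _ _ hr.le, ← ENNReal.rpow_mul, ← ENNReal.rpow_mul,
      one_div_mul_cancel hr.ne', ENNReal.rpow_one]
    congr 2
    rw [ENNReal.toReal_one, sub_mul, one_div_mul_cancel hr.ne']
    simp
  have hjoint : AEMeasurable (fun q : ℝ × ℝ => ‖h (q.1 - q.2)‖ₑ ^ r) (volume.prod ν) :=
    ((hh.comp_quasiMeasurePreserving
      (quasiMeasurePreserving_sub_of_right_invariant volume ν)).enorm.pow_const r)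
  have hint : ∫⁻ x, ‖F x‖ₑ ^ r ∂τ ≤ (ν univ * eLpNorm h p volume) ^ r := by
    calc ∫⁻ x, ‖F x‖ₑ ^ r ∂τ
        ≤ ∫⁻ x, (∫⁻ s, ‖h (x - s)‖ₑ ^ r ∂ν) * ν univ ^ (r - 1) ∂τ := by
          refine lintegral_mono_ae ?_
          filter_upwards [hF] with x hx
          exact (ENNReal.rpow_le_rpow hx hr.le).trans (hslice x)
      _ ≤ ∫⁻ x, (∫⁻ s, ‖h (x - s)‖ₑ ^ r ∂ν) * ν univ ^ (r - 1) := lintegral_mono' hτ le_rfl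
      _ = (∫⁻ x, ∫⁻ s, ‖h (x - s)‖ₑ ^ r ∂ν) * ν univ ^ (r - 1) :=
          lintegral_mul_const' _ _ (ENNReal.rpow_ne_top_of_nonneg (by linarith)
            (measure_ne_top ν univ))
      _ = (∫⁻ s, ∫⁻ x, ‖h (x - s)‖ₑ ^ r ∂volume ∂ν) * ν univ ^ (r - 1) := by
          rw [lintegral_lintegral_swap hjoint]
      _ = (ν univ * ∫⁻ x, ‖h x‖ₑ ^ r) * ν univ ^ (r - 1) := by
          congr 1
          simp_rw [lintegral_sub_right_eq_self (fun x => ‖h x‖ₑ ^ r)]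
          rw [lintegral_const, mul_comm]
      _ = (ν univ * eLpNorm h p volume) ^ r := by
          rw [ENNReal.mul_rpow_of_nonneg _ _ hr.le, eLpNorm_eq_lintegral_rpow_enorm_toReal hp0 hp',
            ← ENNReal.rpow_mul, one_div_mul_cancel hr.ne', ENNReal.rpow_one]
          have : ν univ ^ r = ν univ * ν univ ^ (r - 1) := by
            have := ENNReal.rpow_add_of_nonneg (x := ν univ) 1 (r - 1) zero_le_one (by linarith)
            rwa [ENNReal.rpow_one, add_sub_cancel] at this
          rw [this]
          ring
  rw [eLpNorm_eq_lintegral_rpow_enorm_toReal hp0 hp']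
  refine (ENNReal.rpow_le_rpow hint (by positivity)).trans (le_of_eq ?_)
  rw [← ENNReal.rpow_mul, mul_one_div_cancel hr.ne', ENNReal.rpow_one]

theorem lintegral_indicator_inv_add_abs {ε R : ℝ} (hε : 0 < ε) (hR : 0 ≤ R) :
    ∫⁻ s : ℝ, ENNReal.ofReal ((Iic R).indicator (fun s => (ε + s)⁻¹) |s|)
      = ENNReal.ofReal (2 * Real.log (1 + R / ε)) := by
  have hval : ∫ s : ℝ, (Iic R).indicator (fun s => (ε + s)⁻¹) |s|
      = 2 * Real.log (1 + R / ε) := by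
    rw [integral_comp_abs (f := (Iic R).indicator (fun s => (ε + s)⁻¹)),
      setIntegral_indicator measurableSet_Iic, Ioi_inter_Iic,
      ← intervalIntegral.integral_of_le hR]
    congr 1
    have hpos : ∀ x ∈ uIcc 0 R, 0 < ε + x := fun x hx => by
      rw [uIcc_of_le hR] at hx
      linarith [hx.1]
    rw [intervalIntegral.integral_eq_sub_of_hasDerivAt (f := fun s => Real.log (ε + s))]
    · rw [← Real.log_div (by positivity) (by positivity)]
      congr 1
      field_simp
      ring
    · intro x hx
      have := ((hasDerivAt_id x).const_add ε).log (hpos x hx).ne'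
      simpa using this
    · refine ContinuousOn.intervalIntegrable ?_
      exact ContinuousOn.inv₀ (by fun_prop) fun x hx => (hpos x hx).ne'
  rw [← hval, ofReal_integral_eq_lintegral_ofReal]
  · -- the integrand is bounded with support in `[-R, R]`
    have h1 : IntegrableOn (fun s : ℝ => (ε + |s|)⁻¹) (Icc (-R) R) :=
      ContinuousOn.integrableOn_Icc (Continuous.continuousOn
        (Continuous.inv₀ (by fun_prop) fun x => by positivity))
    rw [← integrable_indicator_iff measurableSet_Icc] at h1
    refine h1.congr (Eventually.of_forall fun s => ?_)
    beta_reduce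
    by_cases hs : |s| ≤ R
    · rw [indicator_of_mem (show s ∈ Icc (-R) R from abs_le.mp hs),
        indicator_of_mem (show |s| ∈ Iic R from hs)]
    · rw [indicator_of_notMem (show s ∉ Icc (-R) R from fun h => hs (abs_le.mpr h)),
        indicator_of_notMem (show |s| ∉ Iic R from hs)]
  · refine Eventually.of_forall fun s => ?_
    by_cases hs : |s| ≤ R
    · simp only [Pi.zero_apply]
      rw [indicator_of_mem (show |s| ∈ Iic R from hs)]
      positivity
    · simp only [Pi.zero_apply]
      rw [indicator_of_notMem (show |s| ∉ Iic R from hs)]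

/-! ### Rescaled kernels -/

theorem norm_scaledKernel_le {m : ℕ} {K : ℝ → ℂ} {C : ℝ} (hK : KernelDecay m K C) {ε : ℝ}
    (hε : 0 < ε) (y : ℝ) : ‖scaledKernel K ε y‖ ≤ C * ε ^ m / (ε + |y|) ^ (m + 1) := by
  have h0 : 0 < ε + |y| := by positivity
  rw [scaledKernel, norm_mul, norm_inv, Complex.norm_real, Real.norm_of_nonneg hε.le]
  calc ε⁻¹ * ‖K (y / ε)‖ ≤ ε⁻¹ * (C / (1 + |y / ε|) ^ (m + 1)) := by
        gcongr
        exact hK _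
    _ = C * ε ^ m / (ε + |y|) ^ (m + 1) := by
        rw [abs_div, abs_of_pos hε, show 1 + |y| / ε = (ε + |y|) / ε by field_simp,
          div_pow, pow_succ]
        field_simp
        ring

theorem KernelDecay.nonneg {m : ℕ} {K : ℝ → ℂ} {C : ℝ} (hK : KernelDecay m K C) : 0 ≤ C := by
  simpa using (norm_nonneg _).trans (hK 0)

theorem integrable_scaledKernel {K : ℝ → ℂ} (hK : Integrable K) {ε : ℝ} (hε : 0 < ε) :
    Integrable (scaledKernel K ε) :=
  (hK.comp_div hε.ne').const_mul _

theorem integral_scaledKernel {K : ℝ → ℂ} (hK : ∫ x, K x = 1) {ε : ℝ} (hε : 0 < ε) :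
    ∫ x, scaledKernel K ε x = 1 := by
  simp only [scaledKernel]
  rw [integral_const_mul, Measure.integral_comp_div K ε, hK, abs_of_pos hε]
  have : (ε : ℂ) ≠ 0 := by exact_mod_cast hε.ne'
  simp [this]

theorem scaledKernel_moments {K : ℝ → ℂ} {ε : ℝ} (hε : 0 < ε) {j : ℕ}
    (hi : Integrable (fun x : ℝ => K x * (x : ℂ) ^ j)) (h0 : ∫ x : ℝ, K x * (x : ℂ) ^ j = 0) :
    Integrable (fun x : ℝ => scaledKernel K ε x * (x : ℂ) ^ j) ∧
      ∫ x : ℝ, scaledKernel K ε x * (x : ℂ) ^ j = 0 := by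
  have hne : (ε : ℂ) ≠ 0 := by exact_mod_cast hε.ne'
  have e : (fun x : ℝ => scaledKernel K ε x * (x : ℂ) ^ j) = fun x : ℝ =>
      ((ε : ℂ)⁻¹ * (ε : ℂ) ^ j) * (K (x / ε) * ((x / ε : ℝ) : ℂ) ^ j) := by
    funext x
    simp only [scaledKernel]
    push_cast
    rw [div_pow]
    field_simp
  rw [e]
  refine ⟨(hi.comp_div hε.ne').const_mul _, ?_⟩
  rw [integral_const_mul, Measure.integral_comp_div (fun x : ℝ => K x * (x : ℂ) ^ j) ε, h0]
  simp

/-! ### Convolution of a kernel with a finite measure -/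

/-- Joint measurability with respect to Lebesgue measure in `x` and an arbitrary measure in `y`. For
fixed `x`, the function `y ↦ k (x - y)` need not be measurable for a singular `μ`; it is so for
almost every `x`. -/
theorem aestronglyMeasurable_kernel_sub {k : ℝ → ℂ} (hk : AEStronglyMeasurable k) (μ : Measure ℝ)
    [SFinite μ] : AEStronglyMeasurable (fun q : ℝ × ℝ => k (q.1 - q.2)) (volume.prod μ) :=
  hk.comp_quasiMeasurePreserving (quasiMeasurePreserving_sub_of_right_invariant volume μ)

theorem aestronglyMeasurable_integral_kernel_sub_mul {k : ℝ → ℂ} (hk : AEStronglyMeasurable k)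
    (μ : Measure ℝ) [SFinite μ] {c : ℝ → ℂ} (hc : Continuous c) :
    AEStronglyMeasurable (fun x => ∫ y, k (x - y) * c y ∂μ) :=
  AEStronglyMeasurable.integral_prod_right'
    ((aestronglyMeasurable_kernel_sub hk μ).mul (hc.comp continuous_snd).aestronglyMeasurable)

theorem ae_integrable_kernel_sub_mul {k : ℝ → ℂ} (hk : AEStronglyMeasurable k) {B : ℝ}
    (hB : ∀ x, ‖k x‖ ≤ B) (μ : Measure ℝ) [IsFiniteMeasure μ] {c : ℝ → ℂ} (hc : Continuous c)
    (hc1 : ∀ y, ‖c y‖ ≤ 1) : ∀ᵐ x, Integrable (fun y => k (x - y) * c y) μ := by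
  filter_upwards [(aestronglyMeasurable_kernel_sub hk μ).prodMk_left] with x hx
  refine Integrable.of_bound (hx.mul hc.aestronglyMeasurable) B (Eventually.of_forall fun y => ?_)
  rw [norm_mul]
  have := mul_le_mul (hB (x - y)) (hc1 y) (norm_nonneg _) ((norm_nonneg _).trans (hB 0))
  simpa using this

/-- On a set where `μ` is absolutely continuous, `μ` has density `acDensity μ`. -/
theorem integral_eq_integral_mul_acDensity {μ : Measure ℝ} [IsFiniteMeasure μ] {U : Set ℝ}
    (hU : MeasurableSet U) (hμ : μ.restrict U ≪ volume) {F : ℝ → ℂ} (hF : ∀ y ∉ U, F y = 0) :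
    ∫ y, F y ∂μ = ∫ y, F y * (acDensity μ y : ℂ) := by
  rw [← setIntegral_eq_integral_of_forall_compl_eq_zero hF, ← integral_rnDeriv_smul hμ]
  refine integral_congr_ae ?_
  filter_upwards [Measure.rnDeriv_restrict μ volume hU] with y hy
  rw [hy]
  by_cases h : y ∈ U
  · rw [indicator_of_mem h, acDensity, Complex.real_smul, mul_comm]
  · simp [hF y h]

/-! ### The Sobolev norm -/

theorem MemSobolev.isWeakDerivOn_weakDerivOn {U : Set ℝ} {m : ℕ} {p : ℝ≥0∞} {u : ℝ → ℝ}
    (hu : MemSobolev U m p u) {j : ℕ} (hj : j ≤ m) : IsWeakDerivOn U j u (weakDerivOn U j u) := by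
  obtain ⟨v, hv, -⟩ := hu j hj
  have h : ∃ v : ℝ → ℝ, IsWeakDerivOn U j u v := ⟨v, hv⟩
  rw [weakDerivOn, dif_pos h]
  exact h.choose_spec

theorem MemSobolev.memLp_weakDerivOn {U : Set ℝ} (hU : IsOpen U) {m : ℕ} {p : ℝ≥0∞} {u : ℝ → ℝ}
    (hu : MemSobolev U m p u) {j : ℕ} (hj : j ≤ m) :
    MemLp (weakDerivOn U j u) p (volume.restrict U) := by
  obtain ⟨v, hv, hvp⟩ := hu j hj
  exact hvp.ae_eq (hv.ae_eq hU (hu.isWeakDerivOn_weakDerivOn hj))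

theorem sobolevNorm_nonneg (U : Set ℝ) (m : ℕ) (p : ℝ≥0∞) (u : ℝ → ℝ) : 0 ≤ sobolevNorm U m p u :=
  Real.rpow_nonneg (Finset.sum_nonneg fun _ _ => Real.rpow_nonneg ENNReal.toReal_nonneg _) _

theorem MemSobolev.eLpNorm_weakDerivOn_le {U : Set ℝ} (hU : IsOpen U) {m : ℕ} {p : ℝ≥0∞}
    (hp : 1 ≤ p) (hp' : p ≠ ⊤) {u : ℝ → ℝ} (hu : MemSobolev U m p u) {j : ℕ} (hj : j ≤ m) :
    eLpNorm (weakDerivOn U j u) p (volume.restrict U) ≤ ENNReal.ofReal (sobolevNorm U m p u) := by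
  have hr : 0 < p.toReal := ENNReal.toReal_pos (zero_lt_one.trans_le hp).ne' hp'
  rw [← ENNReal.ofReal_toReal (hu.memLp_weakDerivOn hU hj).eLpNorm_ne_top]
  refine ENNReal.ofReal_le_ofReal ?_
  have h1 : (eLpNorm (weakDerivOn U j u) p (volume.restrict U)).toReal ^ p.toReal ≤
      ∑ j ∈ Finset.range (m + 1),
        (eLpNorm (weakDerivOn U j u) p (volume.restrict U)).toReal ^ p.toReal :=
    Finset.single_le_sum
      (f := fun j => (eLpNorm (weakDerivOn U j u) p (volume.restrict U)).toReal ^ p.toReal)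
      (fun i _ => Real.rpow_nonneg ENNReal.toReal_nonneg _) (Finset.mem_range.mpr (by omega))
  have h2 := Real.rpow_le_rpow (Real.rpow_nonneg ENNReal.toReal_nonneg _) h1
    (one_div_nonneg.mpr hr.le)
  rwa [← Real.rpow_mul ENNReal.toReal_nonneg, mul_one_div_cancel hr.ne', Real.rpow_one] at h2

theorem ProjectionValuedMeasure.isProbabilityMeasure_spectralMeasure {H : Type*}
    [NormedAddCommGroup H] [InnerProductSpace ℂ H] [CompleteSpace H]
    (E : ProjectionValuedMeasure H) {f : H} (hf : ‖f‖ = 1) :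
    IsProbabilityMeasure (E.spectralMeasure f) := by
  refine ⟨?_⟩
  rw [E.spectralMeasure_apply f MeasurableSet.univ, E.map_univ]
  simp [inner_self_eq_norm_sq_to_K, hf]

/-! ### The approximation error -/

/-- The mass at distance at least `η / 2` from `(a, b)` is controlled by the decay of the kernel
alone. -/
theorem eLpNorm_far_part_le {m : ℕ} {K : ℝ → ℂ} {C : ℝ} (hK : KernelDecay m K C)
    (μ : Measure ℝ) [IsProbabilityMeasure μ] {p : ℝ≥0∞} {a b η ε : ℝ} (hab : a < b) (hη : 0 < η)
    (hε : 0 < ε) {χ : ℝ → ℝ} (h0 : ∀ x, 0 ≤ χ x) (h1 : ∀ x, χ x ≤ 1)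
    (hχ : ∀ x ∈ Icc (a - η / 2) (b + η / 2), χ x = 1) :
    eLpNorm (fun x => ∫ y, scaledKernel K ε (x - y) * ((1 - χ y : ℝ) : ℂ) ∂μ) p
        (volume.restrict (Ioo a b)) ≤
      ENNReal.ofReal (C * (b - a) ^ (1 / p.toReal) / (ε + η / 2) ^ (m + 1) * ε ^ m) := by
  have hC := hK.nonneg
  have hbd : ∀ᵐ x ∂(volume.restrict (Ioo a b)),
      ‖∫ y, scaledKernel K ε (x - y) * ((1 - χ y : ℝ) : ℂ) ∂μ‖
        ≤ C * ε ^ m / (ε + η / 2) ^ (m + 1) := by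
    filter_upwards [ae_restrict_mem measurableSet_Ioo] with x hx
    refine (norm_integral_le_of_norm_le_const (C := C * ε ^ m / (ε + η / 2) ^ (m + 1))
      (Eventually.of_forall fun y => ?_)).trans (by simp)
    rw [norm_mul, Complex.norm_real, Real.norm_of_nonneg (by linarith [h1 y])]
    by_cases hy : y ∈ Icc (a - η / 2) (b + η / 2)
    · rw [hχ y hy, sub_self, mul_zero]
      positivity
    · have hxy : η / 2 ≤ |x - y| := by
        rw [mem_Icc, not_and_or, not_le, not_le] at hy
        rcases hy with hy | hy
        · exact le_trans (by linarith [hx.1]) (le_abs_self _)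
        · exact le_trans (by linarith [hx.2]) (neg_le_abs _)
      calc ‖scaledKernel K ε (x - y)‖ * (1 - χ y)
          ≤ C * ε ^ m / (ε + |x - y|) ^ (m + 1) * 1 := by
            refine mul_le_mul (norm_scaledKernel_le hK hε _) (by linarith [h0 y])
              (by linarith [h1 y]) (by positivity)
        _ ≤ C * ε ^ m / (ε + η / 2) ^ (m + 1) := by
            rw [mul_one]
            gcongr
  refine (eLpNorm_le_of_ae_bound hbd).trans (le_of_eq ?_)
  rw [Measure.restrict_apply_univ, Real.volume_Ioo,
    ENNReal.ofReal_rpow_of_pos (by linarith), ← ENNReal.ofReal_mul (by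
      have : 0 < b - a := by linarith
      positivity), one_div]
  congr 1
  ring

/-- The part of the error governed by the smoothness of `g` near `(a, b)`: only the values of the
residual kernel on an interval of length comparable to that of the support of `h` matter. -/
theorem eLpNorm_near_part_le {n : ℕ} {k : ℝ → ℂ} {A ε : ℝ} (hε : 0 < ε) (hA : 0 ≤ A)
    (hk : ∀ y, ‖k y‖ ≤ A / (ε + |y|) ^ (n + 2)) (hi : Integrable k) (h1 : ∫ y, k y = 1)
    (hmom : ∀ j : ℕ, 0 < j → j < n + 1 →
      Integrable (fun x : ℝ => k x * (x : ℂ) ^ j) ∧ ∫ x : ℝ, k x * (x : ℂ) ^ j = 0)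
    {p : ℝ≥0∞} (hp : 1 ≤ p) (hp' : p ≠ ⊤) {a b η : ℝ} (hab : a < b) (hη : 0 < η) {g h : ℝ → ℝ}
    (hh : Integrable h) (hS : ∀ x ∉ Ioo (a - η) (b + η), h x = 0)
    (hg : ∀ᵐ x, g x = ∫ s, cauchyKernel n s * h (x - s)) {F : ℝ → ℂ}
    (hF : ∀ᵐ x ∂(volume.restrict (Ioo a b)), F x = (g x : ℂ) - ∫ y, k y * (g (x - y) : ℂ)) :
    eLpNorm F p (volume.restrict (Ioo a b)) ≤
      ENNReal.ofReal (4 * A / (n.factorial : ℝ) * Real.log (1 + (b - a + 2 * η) / ε))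
        * eLpNorm h p volume := by
  set R := b - a + 2 * η
  have hR : 0 ≤ R := by simp only [R]; linarith
  set c := 2 * A / (n.factorial : ℝ)
  have hc : 0 ≤ c := by positivity
  set κ : ℝ → ℝ≥0∞ := fun s =>
    ENNReal.ofReal c * ENNReal.ofReal ((Iic R).indicator (fun s => (ε + s)⁻¹) |s|)
  have hκm : Measurable κ := by
    have hm : Measurable ((Iic R).indicator fun s => (ε + s)⁻¹) :=
      Measurable.indicator (by fun_prop) measurableSet_Iic
    exact (ENNReal.measurable_ofReal.comp (hm.comp continuous_abs.measurable)).const_mul _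
  have hκ : ∫⁻ s, κ s = ENNReal.ofReal (4 * A / (n.factorial : ℝ) * Real.log (1 + R / ε)) := by
    rw [lintegral_const_mul' _ _ ENNReal.ofReal_ne_top, lintegral_indicator_inv_add_abs hε hR,
      ← ENNReal.ofReal_mul hc]
    congr 1
    simp only [c]
    ring
  set ν : Measure ℝ := volume.withDensity κ
  have hν : ν univ = ENNReal.ofReal (4 * A / (n.factorial : ℝ) * Real.log (1 + R / ε)) := by
    rw [withDensity_apply _ MeasurableSet.univ, Measure.restrict_univ, hκ]
  have : IsFiniteMeasure ν := ⟨by rw [hν]; exact ENNReal.ofReal_lt_top⟩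
  rw [← hν]
  have hS' : ∀ x, |a| + |b| + η < |x| → h x = 0 := fun x hx => hS x fun hx' => by
    have h1 := neg_abs_le a
    have h2 := le_abs_self b
    have h3 := abs_nonneg a
    have h4 := abs_nonneg b
    have : |x| ≤ |a| + |b| + η := abs_le.mpr ⟨by linarith [hx'.1], by linarith [hx'.2]⟩
    linarith
  refine eLpNorm_le_of_enorm_le_lintegral_sub hp hp' (withDensity_absolutelyContinuous _ _)
    Measure.restrict_le_self hh.aestronglyMeasurable ?_
  filter_upwards [hF, ae_restrict_of_ae hg, ae_restrict_mem measurableSet_Ioo] with x hx hgx hxab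
  rw [hx, sub_integral_eq_integral_residualKernel hε hA hk hi hh hS' hg hgx]
  refine (enorm_integral_le_lintegral_enorm _).trans ?_
  have hhx : AEMeasurable (fun s => ‖h (x - s)‖ₑ) :=
    (hh.comp_sub_left x).aestronglyMeasurable.enorm
  rw [lintegral_withDensity_eq_lintegral_mul₀ hκm.aemeasurable hhx]
  refine lintegral_mono fun s => ?_
  simp only [Pi.mul_apply, enorm_mul]
  by_cases hs : x - s ∈ Ioo (a - η) (b + η)
  · have hsR : |s| ≤ R := abs_le.mpr
      ⟨by simp only [R]; linarith [hs.2, hxab.1], by simp only [R]; linarith [hs.1, hxab.2]⟩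
    have e : ‖((h (x - s) : ℝ) : ℂ)‖ₑ = ‖h (x - s)‖ₑ := by
      rw [← ofReal_norm, ← ofReal_norm, Complex.norm_real]
    rw [e]
    gcongr
    simp only [κ]
    rw [← ENNReal.ofReal_mul hc, indicator_of_mem (show |s| ∈ Iic R from hsR),
      ← ofReal_norm]
    exact ENNReal.ofReal_le_ofReal (norm_residualKernel_le hε hA hk hi h1 hmom s)
  · simp [hS _ hs]

/-- The error of the smoothed measure, in terms of the constant `M` of a family of cutoffs. -/
theorem eLpNorm_acDensity_sub_smoothedMeasure_le {n : ℕ} {K : ℝ → ℂ}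
    (hK : IsKernelOfOrder (n + 1) K) {C : ℝ} (hC : KernelDecay (n + 1) K C) (μ : Measure ℝ)
    [IsProbabilityMeasure μ] {p : ℝ≥0∞} (hp : 1 ≤ p) (hp' : p ≠ ⊤) {a b η : ℝ} (hab : a < b)
    (hη : 0 < η) (hμ : μ.restrict (Ioo (a - η) (b + η)) ≪ volume)
    (hu : MemSobolev (Ioo (a - η) (b + η)) (n + 1) p (acDensity μ)) {M : ℝ} (hM : 0 ≤ M)
    {χ : ℝ → ℝ} (c1 : ContDiff ℝ ∞ χ) (c2 : HasCompactSupport χ)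
    (c3 : tsupport χ ⊆ Ioo (a - η) (b + η)) (c4 : ∀ x, 0 ≤ χ x) (c5 : ∀ x, χ x ≤ 1)
    (c6 : ∀ x ∈ Icc (a - η / 2) (b + η / 2), χ x = 1)
    (c7 : ∀ i ≤ n + 1, ∀ x, |iteratedDeriv i χ x| ≤ M * (1 + (η ^ (n + 1))⁻¹))
    {ε : ℝ} (hε : 0 < ε) :
    AEStronglyMeasurable (fun x => (acDensity μ x : ℂ) - smoothedMeasure K ε μ x)
        (volume.restrict (Ioo a b)) ∧
      eLpNorm (fun x => (acDensity μ x : ℂ) - smoothedMeasure K ε μ x) p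
        (volume.restrict (Ioo a b)) ≤
      ENNReal.ofReal (C * (b - a) ^ (1 / p.toReal) / (ε + η / 2) ^ (n + 1 + 1) * ε ^ (n + 1)
        + (4 * 2 ^ (n + 1) * M / (n.factorial : ℝ)) * C
          * sobolevNorm (Ioo (a - η) (b + η)) (n + 1) p (acDensity μ)
          * (1 + (η ^ (n + 1))⁻¹) * Real.log (1 + (b - a + 2 * η) / ε) * ε ^ (n + 1)) := by
  set U := Ioo (a - η) (b + η)
  have hU : IsOpen U := isOpen_Ioo
  set ρ := acDensity μ
  set k := scaledKernel K ε
  have hC0 := hC.nonneg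
  have hki : Integrable k := integrable_scaledKernel hK.integrable hε
  have hkm := hki.aestronglyMeasurable
  have hkb : ∀ y, ‖k y‖ ≤ C * ε ^ (n + 1) / (ε + |y|) ^ (n + 2) := norm_scaledKernel_le hC hε
  have hkb' : ∀ y, ‖k y‖ ≤ C * ε ^ (n + 1) / ε ^ (n + 2) := fun y => (hkb y).trans (by
    gcongr
    linarith [abs_nonneg y])
  have hρm : Measurable ρ := (Measure.measurable_rnDeriv μ volume).ennreal_toReal
  -- measurability of the error
  have hsm : AEStronglyMeasurable (smoothedMeasure K ε μ) := by
    have := aestronglyMeasurable_integral_kernel_sub_mul hkm μ (continuous_const (y := (1 : ℂ)))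
    simp only [mul_one] at this
    exact this
  have hFm : AEStronglyMeasurable (fun x => (ρ x : ℂ) - smoothedMeasure K ε μ x) :=
    (Complex.measurable_ofReal.comp hρm).aestronglyMeasurable.sub hsm
  refine ⟨hFm.restrict, ?_⟩
  set F2 : ℝ → ℂ := fun x => ∫ y, k (x - y) * ((1 - χ y : ℝ) : ℂ) ∂μ
  have hχc : Continuous fun y => ((χ y : ℝ) : ℂ) := Complex.continuous_ofReal.comp c1.continuous
  have hχc' : Continuous fun y => ((1 - χ y : ℝ) : ℂ) :=
    Complex.continuous_ofReal.comp (continuous_const.sub c1.continuous)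
  have hF2m : AEStronglyMeasurable F2 :=
    aestronglyMeasurable_integral_kernel_sub_mul hkm μ hχc'
  set F1 : ℝ → ℂ := fun x => ((ρ x : ℂ) - smoothedMeasure K ε μ x) + F2 x
  have hF1m : AEStronglyMeasurable F1 := hFm.add hF2m
  -- the localized density and its derivatives
  set v : ℕ → ℝ → ℝ := fun j => weakDerivOn U j ρ
  have hv : ∀ j ≤ n + 1, LocallyIntegrableOn (v j) U := fun j hj =>
    (hu.isWeakDerivOn_weakDerivOn hj).2.1
  have hρl : LocallyIntegrableOn ρ U := (hu.isWeakDerivOn_weakDerivOn (Nat.zero_le _)).1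
  have hv0 : v 0 =ᵐ[volume.restrict U] ρ :=
    (hu.isWeakDerivOn_weakDerivOn (Nat.zero_le _)).ae_eq hU
      ⟨hρl, hρl, fun φ _ _ _ => by simp⟩
  set g : ℝ → ℝ := fun x => χ x * ρ x
  set h := leibnizSum (n + 1) χ v
  have hgi : Integrable g := hρl.integrable_mul_of_tsupport_subset c1.continuous c2 c3
  have hhi : Integrable h := integrable_leibnizSum (n + 1) c1 c2 c3 hv
  have hh0 : ∀ x ∉ U, h x = 0 := fun x hx => leibnizSum_eq_zero _ _ _ fun h' => hx (c3 h')
  have hχ0 : ∀ x ∉ U, χ x = 0 := fun x hx =>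
    image_eq_zero_of_notMem_tsupport fun h' => hx (c3 h')
  have hgv : ∀ᵐ x, χ x * v 0 x = g x := by
    rw [EventuallyEq, ae_restrict_iff' hU.measurableSet] at hv0
    filter_upwards [hv0] with x hx
    by_cases hxU : x ∈ U
    · rw [hx hxU]
    · simp [g, hχ0 x hxU]
  have hS' : ∀ x, |a| + |b| + η < |x| → h x = 0 := fun x hx => hh0 x fun hx' => by
    have h1 := neg_abs_le a
    have h2 := le_abs_self b
    have h3 := abs_nonneg a
    have h4 := abs_nonneg b
    have : |x| ≤ |a| + |b| + η := abs_le.mpr ⟨by linarith [hx'.1], by linarith [hx'.2]⟩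
    linarith
  have hcauchy : ∀ᵐ x, g x = ∫ s, cauchyKernel n s * h (x - s) := by
    refine ae_eq_integral_cauchyKernel_mul n hgi hhi hS' fun Φ hΦ => ?_
    rw [integral_leibnizSum_mul (n + 1) c1 c2 c3 hv (fun j hj =>
      (hu.isWeakDerivOn_weakDerivOn hj.le).succ (hu.isWeakDerivOn_weakDerivOn hj)) hΦ]
    congr 1
    refine integral_congr_ae ?_
    filter_upwards [hgv] with x hx
    rw [hx]
  -- on `(a, b)` the first part is the approximation error of the localized density
  have hF1 : ∀ᵐ x ∂(volume.restrict (Ioo a b)),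
      F1 x = (g x : ℂ) - ∫ y, k y * (g (x - y) : ℂ) := by
    have i1 := ae_integrable_kernel_sub_mul hkm hkb' μ hχc (fun y => by
      rw [Complex.norm_real, Real.norm_of_nonneg (c4 y)]; exact c5 y)
    have i2 := ae_integrable_kernel_sub_mul hkm hkb' μ hχc' (fun y => by
      rw [Complex.norm_real, Real.norm_of_nonneg (by linarith [c5 y])]; linarith [c4 y])
    filter_upwards [ae_restrict_of_ae i1, ae_restrict_of_ae i2, ae_restrict_mem measurableSet_Ioo]
      with x hx1 hx2 hx
    have e1 : smoothedMeasure K ε μ x = (∫ y, k (x - y) * (χ y : ℂ) ∂μ) + F2 x := by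
      simp only [F2]
      rw [← integral_add hx1 hx2, smoothedMeasure]
      refine integral_congr_ae (Eventually.of_forall fun y => ?_)
      simp only [k]
      push_cast
      ring
    have e2 : ∫ y, k (x - y) * (χ y : ℂ) ∂μ = ∫ y, k y * (g (x - y) : ℂ) := by
      rw [integral_eq_integral_mul_acDensity hU.measurableSet hμ
        (fun y hy => by rw [hχ0 y hy]; simp),
        ← integral_sub_left_eq_self (fun y => k y * (g (x - y) : ℂ)) volume x]
      refine integral_congr_ae (Eventually.of_forall fun y => ?_)
      simp only [g, ρ, sub_sub_cancel]
      push_cast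
      ring
    have e3 : g x = ρ x := by
      simp only [g]
      rw [c6 x ⟨by linarith [hx.1], by linarith [hx.2]⟩, one_mul]
    simp only [F1]
    rw [e1, e2, e3]
    ring
  have hA : 0 ≤ C * ε ^ (n + 1) := by positivity
  have hlog : 0 ≤ Real.log (1 + (b - a + 2 * η) / ε) := by
    refine Real.log_nonneg ?_
    have : 0 ≤ (b - a + 2 * η) / ε := div_nonneg (by linarith) hε.le
    linarith
  have hnear := eLpNorm_near_part_le hε hA hkb hki (integral_scaledKernel hK.integral_eq_one hε)
    (fun j hj hj' => scaledKernel_moments hε (hK.moments j hj hj').1 (hK.moments j hj hj').2)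
    hp hp' hab hη hhi hh0 hcauchy hF1
  have hfar := eLpNorm_far_part_le (p := p) hC μ hab hη hε c4 c5 c6
  have hhp := eLpNorm_leibnizSum_le hU.measurableSet (n + 1) hp c1 c2 c3 c7 hv
    (fun j hj => hu.eLpNorm_weakDerivOn_le hU hp hp' hj)
  have hB0 : 0 ≤ M * (1 + (η ^ (n + 1))⁻¹) := by positivity
  have hN0 := sobolevNorm_nonneg U (n + 1) p ρ
  have hb : 0 < b - a := by linarith
  have hF : (fun x => (ρ x : ℂ) - smoothedMeasure K ε μ x) = F1 - F2 := by
    funext x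
    simp [F1]
  rw [hF]
  refine (eLpNorm_sub_le hF1m.restrict hF2m.restrict hp).trans ?_
  rw [add_comm, ENNReal.ofReal_add (by positivity) (by positivity)]
  refine add_le_add hfar (hnear.trans ((mul_le_mul_right hhp _).trans (le_of_eq ?_)))
  rw [← ENNReal.ofReal_mul hB0, show (2 : ℝ≥0∞) ^ (n + 1) = ENNReal.ofReal (2 ^ (n + 1)) by
    rw [ENNReal.ofReal_pow (by norm_num)]; simp, ← ENNReal.ofReal_mul (by positivity),
    ← ENNReal.ofReal_mul (by positivity)]
  congr 1
  ring

/-- The bound of the theorem has the order `ε ^ m * log (1 / ε)`. -/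
theorem isBigO_error_bound (m : ℕ) {c₁ c₂ η R : ℝ} (hc₁ : 0 ≤ c₁) (hc₂ : 0 ≤ c₂) (hη : 0 < η)
    (hR : 0 ≤ R) {e : ℝ → ℝ}
    (he : ∀ ε, 0 < ε → |e ε| ≤
      c₁ / (ε + η / 2) ^ (m + 1) * ε ^ m + c₂ * Real.log (1 + R / ε) * ε ^ m) :
    Asymptotics.IsBigO (𝓝[>] (0 : ℝ)) e (fun ε : ℝ => ε ^ m * Real.log (1 / ε)) := by
  refine Asymptotics.IsBigO.of_bound
    (c₁ / (η / 2) ^ (m + 1) + c₂ * (Real.log (1 + R) + 1)) ?_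
  -- for `ε < 1 / e` one has `1 ≤ log (1 / ε)`, which absorbs the term without a logarithm
  have hlt : (0 : ℝ) < Real.exp (-1) := Real.exp_pos _
  filter_upwards [Ioo_mem_nhdsGT hlt] with ε hε
  have hε0 : 0 < ε := hε.1
  have hε1 : ε ≤ 1 := hε.2.le.trans (Real.exp_le_one_iff.mpr (by norm_num))
  have hL : 1 ≤ Real.log (1 / ε) := by
    rw [one_div, Real.log_inv, le_neg]
    exact (Real.log_le_iff_le_exp hε0).mpr hε.2.le
  have hlR : 0 ≤ Real.log (1 + R) := Real.log_nonneg (by linarith)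
  have hlog : Real.log (1 + R / ε) ≤ (Real.log (1 + R) + 1) * Real.log (1 / ε) := by
    have h1 : 1 + R / ε ≤ (1 + R) * (1 / ε) := by
      have : 1 ≤ 1 / ε := by rw [le_div_iff₀ hε0]; linarith
      calc 1 + R / ε ≤ 1 / ε + R / ε := by linarith
        _ = (1 + R) * (1 / ε) := by ring
    have h2 : Real.log (1 + R / ε) ≤ Real.log ((1 + R) * (1 / ε)) :=
      Real.log_le_log (by positivity) h1
    rw [Real.log_mul (by positivity) (by positivity)] at h2
    nlinarith
  rw [Real.norm_eq_abs, Real.norm_of_nonneg (by positivity)]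
  refine (he ε hε0).trans ?_
  have h3 : c₁ / (ε + η / 2) ^ (m + 1) * ε ^ m
      ≤ c₁ / (η / 2) ^ (m + 1) * (ε ^ m * Real.log (1 / ε)) := by
    have h4 : c₁ / (ε + η / 2) ^ (m + 1) ≤ c₁ / (η / 2) ^ (m + 1) := by
      gcongr
      linarith
    have h5 : ε ^ m ≤ ε ^ m * Real.log (1 / ε) := le_mul_of_one_le_right (by positivity) hL
    exact mul_le_mul h4 h5 (by positivity) (by positivity)
  have h6 : c₂ * Real.log (1 + R / ε) * ε ^ m
      ≤ c₂ * ((Real.log (1 + R) + 1) * Real.log (1 / ε)) * ε ^ m := by gcongr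
  calc _ ≤ c₁ / (η / 2) ^ (m + 1) * (ε ^ m * Real.log (1 / ε))
        + c₂ * ((Real.log (1 + R) + 1) * Real.log (1 / ε)) * ε ^ m := add_le_add h3 h6
    _ = _ := by ring

theorem mainTheorem3 :
    ∃ C : ℕ → ℝ,
      ∀ (H : Type*) [NormedAddCommGroup H] [InnerProductSpace ℂ H] [CompleteSpace H]
        (L : H →ₗ.[ℂ] H) (_ : IsSelfAdjoint L)
        (E : ProjectionValuedMeasure H) (_ : E.IsResolutionOf L)
        (f : H) (_ : ‖f‖ = 1)
        (m : ℕ) (K : ℝ → ℂ) (_ : IsKernelOfOrder m K) (C_K : ℝ) (_ : KernelDecay m K C_K)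
        (p : ℝ≥0∞) (_ : 1 ≤ p) (_ : p ≠ ⊤)
        (a b η : ℝ) (_ : a < b) (_ : 0 < η)
        (_ : (E.spectralMeasure f).restrict (Ioo (a - η) (b + η)) ≪ volume)
        (_ : MemSobolev (Ioo (a - η) (b + η)) m p (acDensity (E.spectralMeasure f))),
        (∀ ε : ℝ, 0 < ε →
          MemLp (fun x => (acDensity (E.spectralMeasure f) x : ℂ)
              - smoothedMeasure K ε (E.spectralMeasure f) x) p (volume.restrict (Ioo a b)) ∧
          eLpNorm (fun x => (acDensity (E.spectralMeasure f) x : ℂ)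
              - smoothedMeasure K ε (E.spectralMeasure f) x) p (volume.restrict (Ioo a b)) ≤
            ENNReal.ofReal
              (C_K * (b - a) ^ (1 / p.toReal) / (ε + η / 2) ^ (m + 1) * ε ^ m
                + C m * C_K
                  * sobolevNorm (Ioo (a - η) (b + η)) m p (acDensity (E.spectralMeasure f))
                  * (1 + (η ^ m)⁻¹) * Real.log (1 + (b - a + 2 * η) / ε) * ε ^ m)) ∧
        Asymptotics.IsBigO (𝓝[>] (0 : ℝ))
          (fun ε : ℝ => (eLpNorm (fun x => (acDensity (E.spectralMeasure f) x : ℂ)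
              - smoothedMeasure K ε (E.spectralMeasure f) x) p
                (volume.restrict (Ioo a b))).toReal)
          (fun ε : ℝ => ε ^ m * Real.log (1 / ε)) := by

  choose M hM0 hM using exists_cutoff
  refine ⟨fun m => 4 * 2 ^ m * M m / ((m - 1).factorial : ℝ), ?_⟩
  intro H _ _ _ L _ E _ f hf m K hK C_K hC p hp hp' a b η hab hη hμ hu
  obtain ⟨n, rfl⟩ : ∃ n, m = n + 1 := ⟨m - 1, by have := hK.pos; omega⟩
  have := E.isProbabilityMeasure_spectralMeasure hf
  obtain ⟨χ, c1, c2, c3, c4, c5, c6, c7⟩ := hM (n + 1) a b η hab hη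
  have key := fun (ε : ℝ) (hε : 0 < ε) => eLpNorm_acDensity_sub_smoothedMeasure_le hK hC
    (E.spectralMeasure f) hp hp' hab hη hμ hu (hM0 (n + 1)) c1 c2 c3 c4 c5 c6 c7 hε
  refine ⟨fun ε hε => ⟨⟨(key ε hε).1, (key ε hε).2.trans_lt ENNReal.ofReal_lt_top⟩,
    (key ε hε).2⟩, ?_⟩
  have hC0 := hC.nonneg
  have hb : 0 < b - a := by linarith
  have hM1 := hM0 (n + 1)
  have hN0 := sobolevNorm_nonneg (Ioo (a - η) (b + η)) (n + 1) p (acDensity (E.spectralMeasure f))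
  refine isBigO_error_bound (n + 1) (c₁ := C_K * (b - a) ^ (1 / p.toReal))
    (c₂ := 4 * 2 ^ (n + 1) * M (n + 1) / (n.factorial : ℝ) * C_K
      * sobolevNorm (Ioo (a - η) (b + η)) (n + 1) p (acDensity (E.spectralMeasure f))
      * (1 + (η ^ (n + 1))⁻¹)) (η := η) (R := b - a + 2 * η)
    (by positivity) (by positivity) hη (by linarith) fun ε hε => ?_
  have hlog : 0 ≤ Real.log (1 + (b - a + 2 * η) / ε) := by
    refine Real.log_nonneg ?_
    have : 0 ≤ (b - a + 2 * η) / ε := div_nonneg (by linarith) hε.le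
    linarith
  rw [abs_of_nonneg ENNReal.toReal_nonneg]
  exact ENNReal.toReal_le_of_le_ofReal (by positivity) (key ε hε).2
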